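/- Let $X$ be a locally noetherian noncommutative space, i.e. a Grothendieck category $\operatorname{Mod}X$ (whose objects are called $X$-modules) with a set of noetherian generators. For an $X$-module $M$ let $\sigma[M]$ (resp. $\pi[M]$) be the smallest full subcategory of $\operatorname{Mod}X$ that contains $M$ and is closed under isomorphisms, subquotients and arbitrary direct sums (resp. arbitrary direct products). For $Z=\sigma[M]$ with inclusion $i$, and a module $K$, let $i^!K$ be the sum of all submodules of $K$ that lie in $Z$. Let $\dim$ be a dimension function on $X$: it assigns to each $X$-module an ordinal or $-1$, such that (a) $\dim M=-1$ iff $M=0$; (b) $\dim N=\sup\{\dim M,\dim K\}$ for each short exact sequence $0\to M\to N\to K\to0$; (c) $\dim N$ is the supremum of the dimensions of the noetherian submodules of $N$; (d) for each strictly descending chain $M=M_0\supset M_1\supset\cdots$ with $M$ noetherian, $\dim M_i/M_{i+1}<\dim M$ for all but finitely many $i$. For an ordinal $\alpha$, a module $M$ is $\alpha$-critical if $\dim M=\alpha$ and $\dim M/N<\alpha$ for all $0\neq N\le M$; it is critical if it is $\alpha$-critical for some ordinal $\alpha$. Let $\mathcal C_{<\alpha}$ be the Serre subcategory of the modules of dimension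 $<\alpha$ and $\pi_\alpha:X\to X/\mathcal C_{<\alpha}$ the quotient functor. An $\alpha$-critical $M$ is tiny if $S=\pi_\alpha M$ is a simple object such that $\operatorname{Hom}(N,S)$ is finite-dimensional over $\operatorname{End}(S)$ for every noetherian object $N$ of $X/\mathcal C_{<\alpha}$. A module $M$ is finitely subgenerated by $N$ if $M\cong B/A$ for some $A\le B\le N^{(t)}$ with $t$ finite. Let $Spec(X)$ be the class of the nonzero modules that are finitely subgenerated by each of their nonzero submodules. Rosenberg's spectrum $\mathbf{Spec}(X)$ is the set of classes $\langle M\rangle$ of $M\in Spec(X)$, where $M$ and $N$ are equivalent if each is finitely subgenerated by the other; it is preordered by $\langle N\rangle\le\langle M\rangle$ iff $N\in\sigma[M]$. Let $\operatorname{Inj}(X)$ be the set of isomorphism classes of indecomposable injective $X$-modules, and $E(x)$ a fixed representative of $x\in\operatorname{Inj}(X)$. For $x,y\in\operatorname{Inj}(X)$ write $x\sqsubseteq y$ if $i^!E(x)\ne0$ for the inclusion $i$ of $\sigma[E(y)]$, and write $x\le y$ if $i^!E(x)\neq0$ for the inclusion $i$ of $\sigma[N]$, for every nonzero submodule $N$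 of $E(y)$. The relation $\le$ is a preorder, and it implies $\sqsubseteq$. **Theorem.** There is a well-defined injective map $\Phi:\mathbf{Spec}(X)\to\operatorname{Inj}(X)$ given by $\Phi(\langle M\rangle)=[E(N)]$, where $N\in Spec(X)$ is any critical module with $\langle N\rangle=\langle M\rangle$ (such an $N$ exists for every $M\in Spec(X)$) and $E(N)$ is its injective hull. It is a map of preordered sets: $\langle M_1\rangle\le\langle M_2\rangle$ implies $\Phi(\langle M_1\rangle)\le\Phi(\langle M_2\rangle)$, and in particular $\Phi(\langle M_1\rangle)\sqsubseteq\Phi(\langle M_2\rangle)$. Suppose moreover that products are exact in $X$ and that $X$ has enough prime modules, i.e. every nonzero $X$-module contains a nonzero submodule $P$ that is prime ($\pi[N]=\pi[P]$ for all $0\ne N\le P$). Then the image of $\Phi$ contains $\mathcal P(X)$, the set of those $x\in\operatorname{Inj}(X)$ for which the largest critical submodule $\tilde{\mathcal O}_x$ of $E(x)$ is tiny. -/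

import Mathlib

open CategoryTheory CategoryTheory.Limits

universe w v u

noncomputable section

namespace NCSpace

attribute [local instance] Abelian.hasFiniteBiproducts

section Subspaces

variable {C : Type u} [Category.{v} C] [Abelian C] [IsGrothendieckAbelian.{v} C]

variable (C) in
/-- `C` is locally noetherian: it has a (small) set of noetherian generators. -/
def IsLocallyNoetherian : Prop :=
  ∃ P : ObjectProperty C, ObjectProperty.Small.{v} P ∧ P ≤ isNoetherianObject ∧ P.IsSeparating

/-- A weakly closed subspace, given by the class of its objects: a full subcategory closed under
isomorphisms, subobjects, quotients and arbitrary (small) direct sums. -/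
structure IsWeaklyClosed (Z : ObjectProperty C) : Prop where
  sub : Z.IsClosedUnderSubobjects
  quot : Z.IsClosedUnderQuotients
  sum : ∀ (I : Type v) (F : I → C), (∀ i, Z (F i)) → Z (∐ F)

/-- A closed subspace, given by the class of its objects: a full subcategory closed under
isomorphisms, subobjects, quotients and arbitrary (small) direct products. -/
structure IsClosedSubspace (Z : ObjectProperty C) : Prop where
  sub : Z.IsClosedUnderSubobjects
  quot : Z.IsClosedUnderQuotients
  prod : ∀ (I : Type v) (F : I → C), (∀ i, Z (F i)) → Z (∏ᶜ F)

/-- `σ[M]`: the smallest weakly closed subspace containing `M`. -/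
def sigma (M : C) : ObjectProperty C :=
  fun N => ∀ Z : ObjectProperty C, IsWeaklyClosed Z → Z M → Z N

/-- `π[M]`: the smallest closed subspace containing `M`. -/
def piHull (M : C) : ObjectProperty C :=
  fun N => ∀ Z : ObjectProperty C, IsClosedSubspace Z → Z M → Z N

/-- `i^! M` for (the inclusion `i` of) a weakly closed subspace `Z`: the sum of all the subobjects
of `M` that lie in `Z`. -/
def support (Z : ObjectProperty C) (M : C) : Subobject M :=
  sSup {N : Subobject M | Z (N : C)}

lemma sigma_isWeaklyClosed (M : C) : IsWeaklyClosed (sigma M) where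
  sub := ⟨fun f _ hY Z hZ hM => hZ.sub.prop_of_mono f (hY Z hZ hM)⟩
  quot := ⟨fun f _ hX Z hZ hM => hZ.quot.prop_of_epi f (hX Z hZ hM)⟩
  sum := fun I F hF Z hZ hM => hZ.sum I F fun i => hF i Z hZ hM

lemma sigma_self (M : C) : sigma M M := fun _ _ h => h

lemma sigma_trans {M N K : C} (h : sigma N K) (h' : sigma M N) : sigma M K :=
  h _ (sigma_isWeaklyClosed M) h'

end Subspaces

section Prime

variable {C : Type u} [Category.{v} C] [Abelian C] [IsGrothendieckAbelian.{v} C]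

/-- `M` is prime: `π[N] = π[M]` for all nonzero `N ≤ M`. -/
def IsPrimeModule (M : C) : Prop :=
  ∀ N : Subobject M, N ≠ ⊥ → piHull M = piHull (N : C)

variable (C) in
/-- Every nonzero module contains a nonzero prime submodule. -/
def EnoughPrimes : Prop :=
  ∀ M : C, ¬ IsZero M → ∃ P : Subobject M, P ≠ ⊥ ∧ IsPrimeModule (P : C)

end Prime

section Spec

variable {C : Type u} [Category.{v} C] [Abelian C]

/-- `M` is finitely subgenerated by `N`: `M ≅ B / A` for some `A ≤ B ≤ N^t`, `t` finite. -/
def FinSubgen (N M : C) : Prop :=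
  ∃ (t : ℕ) (B : C) (i : B ⟶ ⨁ (fun _ : Fin t => N)) (p : B ⟶ M), Mono i ∧ Epi p

lemma FinSubgen.refl (M : C) : FinSubgen M M := by
  refine ⟨1, M, biproduct.ι (fun _ : Fin 1 => M) 0, 𝟙 M, inferInstance, inferInstance⟩

lemma FinSubgen.trans {P N M : C} (h₁ : FinSubgen P N) (h₂ : FinSubgen N M) :
    FinSubgen P M := by
  obtain ⟨s, D, j, q, hj, hq⟩ := h₁
  obtain ⟨t, B, i, p, hi, hp⟩ := h₂
  let Q : (⨁ fun _ : Fin t => D) ⟶ ⨁ fun _ : Fin t => N := biproduct.map fun _ => q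
  let J : (⨁ fun _ : Fin t => D) ⟶ ⨁ fun _ : Fin t => ⨁ fun _ : Fin s => P :=
    biproduct.map fun _ => j
  have hQ : Epi Q := by
    constructor
    intro Z g h e
    apply biproduct.hom_ext'
    intro k
    rw [← cancel_epi q]
    have := biproduct.ι (fun _ : Fin t => D) k ≫= e
    simpa [Q] using this
  have hJ : Mono J := by
    constructor
    intro Z g h e
    apply biproduct.hom_ext
    intro k
    rw [← cancel_mono j]
    have := e =≫ biproduct.π _ k
    simpa [J] using this
  let e₁ : (⨁ fun _ : Fin t => ⨁ fun _ : Fin s => P) ≅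
      ⨁ fun _ : (Σ _ : Fin t, Fin s) => P :=
    biproductBiproductIso (fun _ : Fin t => Fin s) (fun _ _ => P)
  let e₂ : (⨁ fun _ : (Σ _ : Fin t, Fin s) => P) ≅ ⨁ fun _ : Fin (t * s) => P :=
    biproduct.whiskerEquiv ((Equiv.sigmaEquivProd _ _).trans finProdFinEquiv)
      (fun _ => Iso.refl P)
  exact ⟨t * s, pullback Q i, pullback.fst Q i ≫ J ≫ e₁.hom ≫ e₂.hom, pullback.snd Q i ≫ p,
    inferInstance, inferInstance⟩

/-- The class `Spec(X)`: the nonzero modules that are finitely subgenerated by each of their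
nonzero submodules. -/
def IsSpecModule (M : C) : Prop :=
  ¬ IsZero M ∧ ∀ N : Subobject M, N ≠ ⊥ → FinSubgen (N : C) M

variable (C) in
/-- The modules in `Spec(X)`. -/
def SpecModule : Type u := {M : C // IsSpecModule M}

variable (C) in
/-- Two modules in `Spec(X)` are equivalent if each is finitely subgenerated by the other. -/
def specSetoid : Setoid (SpecModule C) where
  r M N := FinSubgen M.1 N.1 ∧ FinSubgen N.1 M.1
  iseqv :=
    { refl := fun M => ⟨FinSubgen.refl M.1, FinSubgen.refl M.1⟩
      symm := fun h => ⟨h.2, h.1⟩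
      trans := fun h h' => ⟨h.1.trans h'.1, h'.2.trans h.2⟩ }

variable (C) in
/-- Rosenberg's spectrum. -/
def Spectrum : Type u := Quotient (specSetoid C)

/-- The class `⟨M⟩`. -/
def Spectrum.mk (M : SpecModule C) : Spectrum C := Quotient.mk (specSetoid C) M

variable [IsGrothendieckAbelian.{v} C]

lemma FinSubgen.sigma {N M : C} (h : FinSubgen N M) : sigma N M := by
  obtain ⟨t, B, i, p, _, _⟩ := h
  intro Z hZ hN
  apply hZ.quot.prop_of_epi p
  apply hZ.sub.prop_of_mono i
  have h := hZ.sum (ULift.{v} (Fin t)) (fun _ => N) fun _ => hN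
  let g : (∐ fun _ : ULift.{v} (Fin t) => N) ⟶ ⨁ fun _ : Fin t => N :=
    Limits.Sigma.desc fun k => biproduct.ι (fun _ : Fin t => N) k.down
  suffices hg : Epi g from hZ.quot.prop_of_epi g h
  constructor
  intro W a b e
  apply biproduct.hom_ext'
  intro k
  have := Limits.Sigma.ι (fun _ : ULift.{v} (Fin t) => N) ⟨k⟩ ≫= e
  simpa [g] using this

/-- The preorder on the spectrum: `⟨N⟩ ≤ ⟨M⟩` if `N ∈ σ[M]`. -/
instance : Preorder (Spectrum C) where
  le p q := Quotient.liftOn₂ p q (fun N M => sigma M.1 N.1) (by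
    intro N M N' M' hN hM
    exact propext ⟨fun h => sigma_trans (sigma_trans hN.1.sigma h) hM.2.sigma,
      fun h => sigma_trans (sigma_trans hN.2.sigma h) hM.1.sigma⟩)
  le_refl p := by
    induction p using Quotient.inductionOn with
    | h M => exact sigma_self M.1
  le_trans p q r := by
    induction p using Quotient.inductionOn
    induction q using Quotient.inductionOn
    induction r using Quotient.inductionOn
    exact fun h h' => sigma_trans h h'

end Spec

section Inj

variable {C : Type u} [Category.{v} C] [Abelian C]

/-- `E` is an injective hull of `N`: it is injective and contains `N` as an essential subobject. -/
def IsInjectiveHull (N E : C) : Prop :=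
  Injective E ∧ ∃ ι : N ⟶ E, ∃ _ : Mono ι,
    ∀ L : Subobject E, L ≠ ⊥ → L ⊓ Subobject.mk ι ≠ ⊥

variable (C) in
/-- The indecomposable injective modules. -/
def IndecInjective : Type u := {E : C // Injective E ∧ Indecomposable E}

variable (C) in
/-- Isomorphism of indecomposable injectives. -/
def injSetoid : Setoid (IndecInjective C) where
  r E F := Nonempty (E.1 ≅ F.1)
  iseqv :=
    { refl := fun E => ⟨Iso.refl E.1⟩
      symm := fun ⟨e⟩ => ⟨e.symm⟩
      trans := fun ⟨e⟩ ⟨f⟩ => ⟨e ≪≫ f⟩ }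

variable (C) in
/-- The injective spectrum: the isomorphism classes of indecomposable injectives. -/
def InjSpectrum : Type u := Quotient (injSetoid C)

/-- The fixed representative `E(x)` of `x`. -/
def InjSpectrum.E (x : InjSpectrum C) : C := (Quotient.out x : IndecInjective C).1

variable [IsGrothendieckAbelian.{v} C]

/-- The relation `i^! E(x) ≠ 0`, where `i` is the inclusion of `σ[E(y)]`. -/
def InjSpectrum.Rel (x y : InjSpectrum C) : Prop :=
  support (sigma y.E) x.E ≠ ⊥

/-- The specialization preorder: `i^! E(x) ≠ 0` where `i` is the inclusion of `σ[N]`, for every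
nonzero submodule `N` of `E(y)`. -/
instance : Preorder (InjSpectrum C) where
  le x y := ∀ N : Subobject y.E, N ≠ ⊥ → support (sigma (N : C)) x.E ≠ ⊥
  le_refl x N hN h := hN (le_bot_iff.1 (h ▸ le_sSup (sigma_self (N : C))))
  le_trans x y z hxy hyz N hN h := by
    refine hyz N hN (sSup_eq_bot.2 fun L hL => ?_)
    by_contra hL'
    refine hxy L hL' (le_bot_iff.1 (h ▸ ?_))
    exact sSup_le_sSup fun K hK => sigma_trans hK hL

end Inj

section Dimension

variable (C : Type u) [Category.{v} C] [Abelian C]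

/-- An (exact, finitely partitive) dimension function. Its values are ordinals or `-1`, which is
`⊥ : WithBot Ordinal`. -/
structure DimensionFunction where
  dim : C → WithBot Ordinal.{w}
  dim_eq_bot_iff : ∀ M : C, dim M = ⊥ ↔ IsZero M
  exact : ∀ S : ShortComplex C, S.ShortExact → dim S.X₂ = max (dim S.X₁) (dim S.X₃)
  isLUB_noetherian : ∀ M : C,
    IsLUB {d | ∃ N : Subobject M, IsNoetherianObject (N : C) ∧ dim (N : C) = d} (dim M)
  finitely_partitive : ∀ (M : C), IsNoetherianObject M →
    ∀ (N : ℕ → Subobject M) (hN : StrictAnti N), N 0 = ⊤ →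
      {i : ℕ | ¬ dim (cokernel (Subobject.ofLE (N (i + 1)) (N i)
        (hN (Nat.lt_succ_self i)).le)) < dim M}.Finite

variable {C}

namespace DimensionFunction

variable (δ : DimensionFunction.{w} C)

/-- `M` is `α`-critical. -/
def IsCriticalOf (α : Ordinal.{w}) (M : C) : Prop :=
  δ.dim M = α ∧ ∀ N : Subobject M, N ≠ ⊥ → δ.dim (cokernel N.arrow) < α

/-- `M` is critical. -/
def IsCritical (M : C) : Prop := ∃ α : Ordinal.{w}, δ.IsCriticalOf α M

/-- `𝒞_{<α}`: the modules of dimension `< α`. -/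
def below (α : Ordinal.{w}) : ObjectProperty C := fun M => δ.dim M < α

instance (α : Ordinal.{w}) : (δ.below α).IsSerreClass where
  exists_zero := ⟨_, isZero_zero C, by
    change δ.dim _ < (α : WithBot Ordinal.{w})
    rw [(δ.dim_eq_bot_iff _).2 (isZero_zero C)]
    exact WithBot.bot_lt_coe α⟩
  prop_of_mono {X Y} f _ hY := by
    have hS : (ShortComplex.mk f (cokernel.π f) (cokernel.condition f)).ShortExact :=
      { exact := ShortComplex.exact_cokernel f }
    have h := δ.exact _ hS
    exact lt_of_le_of_lt (h ▸ le_max_left _ _) hY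
  prop_of_epi {X Y} f _ hX := by
    have hS : (ShortComplex.mk (kernel.ι f) f (kernel.condition f)).ShortExact :=
      { exact := ShortComplex.exact_kernel f }
    have h := δ.exact _ hS
    exact lt_of_le_of_lt (h ▸ le_max_right _ _) hX
  prop_X₂_of_shortExact {S} hS h₁ h₃ := by
    change δ.dim S.X₂ < α
    rw [δ.exact S hS]
    exact max_lt h₁ h₃

/-- The quotient category `X / 𝒞_{<α}`. -/
abbrev QuotientCat (α : Ordinal.{w}) : Type u := (δ.below α).isoModSerre.Localization

/-- The quotient functor `π_α`. -/
abbrev toQuotient (α : Ordinal.{w}) : C ⥤ δ.QuotientCat α := (δ.below α).isoModSerre.Q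

end DimensionFunction

/-- A simple object `S` is tiny if `Hom(N, S)` is finite-dimensional over `End(S)` for all
noetherian `N`. -/
def IsTinySimple {D : Type*} [Category D] [Preadditive D] (S : D) : Prop :=
  Simple S ∧ ∀ N : D, IsNoetherianObject N → Module.Finite (End S) (N ⟶ S)

namespace DimensionFunction

variable (δ : DimensionFunction.{w} C)

/-- `M` is a tiny critical module: for some `α`, it is `α`-critical and `π_α M` is a tiny simple
object of `X / 𝒞_{<α}`. -/
def IsTinyCritical (M : C) : Prop :=
  ∃ α : Ordinal.{w}, δ.IsCriticalOf α M ∧ IsTinySimple ((δ.toQuotient α).obj M)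

/-- `𝒫(X)`: the `x` for which the largest critical submodule of `E(x)` is tiny. -/
def tinyPoints : Set (InjSpectrum C) :=
  {x | ∃ O : Subobject x.E, IsGreatest {N : Subobject x.E | δ.IsCritical (N : C)} O ∧
    δ.IsTinyCritical (O : C)}

end DimensionFunction

end Dimension

end NCSpace

end

/-! Critical modules link the two spectra. Finite partitivity puts a critical submodule inside every
nonzero module, and a nonzero submodule of a module in Spec(X) is again in Spec(X) with the same
class, so every class has critical representatives. A critical module is uniform, hence its
injective hull is indecomposable.

The hull depends only on the class. If critical `Y` and `N` are equivalent, they have the same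
dimension, and some submodule of `Y` maps nontrivially to `N`; such a map between critical modules
of equal dimension is mono, so `Y` and `N` share a nonzero submodule, essential in both
(`exists_common_subobject`). Conversely, two modules of Spec(X) with the same hull meet inside it,
and the intersection represents both classes: this gives injectivity. For monotonicity, a nonzero
submodule of E(N) meets N, and what it meets already subgenerates N.

For a tiny point take a noetherian prime submodule `N` of the critical module and a nonzero `L ≤ N`.
With exact products, π[L] consists of the subquotients of powers of `L`, so `N` is a quotient of
some `B ≤ L^I`, and `B` may be taken noetherian. Tininess makes finitely many coordinates separate
`B`, so `B` embeds in a finite power of `L` (`isSpecModule_of_isPrimeModule`). Hence `N` lies in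
Spec(X), and its hull is all of E(x) by indecomposability. -/

noncomputable section

namespace NCSpace

attribute [local instance] Abelian.hasFiniteBiproducts

/-! ### Noetherian objects: quotients and extensions. -/

section Noetherian

lemma le_iff_factors {C : Type u} [Category.{v} C] {X : C} (F G : Subobject X) :
    F ≤ G ↔ G.Factors F.arrow := by
  constructor
  · intro h
    exact Subobject.factors_of_le F.arrow h (Subobject.factors_self F)
  · intro h
    exact Subobject.le_of_comm (G.factorThru _ h) (by simp)

variable {C : Type u} [Category.{v} C] [Abelian C]

lemma factors_iff_comp_cokernel_eq_zero {X Y : C} (G : Subobject Y) (f : X ⟶ Y) :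
    G.Factors f ↔ f ≫ cokernel.π G.arrow = 0 := by
  constructor
  · intro h
    rw [← G.factorThru_arrow f h, Category.assoc, cokernel.condition, comp_zero]
  · intro h
    rw [← Abelian.monoLift_comp G.arrow f h]
    exact Subobject.factors_of_factors_right _ (Subobject.factors_self G)

lemma factors_of_epi_comp {X Y Z : C} (p : X ⟶ Y) [Epi p] {f : Y ⟶ Z} {G : Subobject Z}
    (h : G.Factors (p ≫ f)) : G.Factors f := by
  rw [factors_iff_comp_cokernel_eq_zero, Category.assoc] at h
  rw [factors_iff_comp_cokernel_eq_zero, ← cancel_epi p, h, comp_zero]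

lemma ne_bot_iff_not_isZero {X : C} (F : Subobject X) : F ≠ ⊥ ↔ ¬ IsZero (F : C) := by
  rw [not_iff_not]
  constructor
  · rintro rfl
    exact (isZero_zero C).of_iso Subobject.botCoeIsoZero
  · intro h
    rw [← Subobject.mk_arrow F, Subobject.mk_eq_bot_iff_zero]
    exact h.eq_of_src _ _

lemma pullback_obj_le_pullback_obj_iff {X Y : C} (p : X ⟶ Y) [Epi p] (F G : Subobject Y) :
    (Subobject.pullback p).obj F ≤ (Subobject.pullback p).obj G ↔ F ≤ G := by
  refine ⟨fun h => ?_, fun h => (Subobject.pullback p).monotone h⟩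
  have hp := Subobject.isPullback p F
  have : Epi (F.pullbackπ p) := (MorphismProperty.epimorphisms C).of_isPullback hp.flip ‹Epi p›
  rw [le_iff_factors]
  refine factors_of_epi_comp (F.pullbackπ p) ?_
  rw [hp.w, ← Subobject.ofLE_arrow h, Category.assoc, ← (Subobject.isPullback p G).w]
  exact Subobject.factors_of_factors_right _ (Subobject.factors_of_factors_right _
    (Subobject.factors_self G))

lemma isNoetherianObject_of_epi {X Y : C} (p : X ⟶ Y) [Epi p] [IsNoetherianObject X] :
    IsNoetherianObject Y := by
  refine ⟨StrictMono.wellFoundedGT (f := fun F => (Subobject.pullback p).obj F) ?_⟩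
  intro F G h
  rw [lt_iff_le_not_ge] at h ⊢
  simpa [pullback_obj_le_pullback_obj_iff] using h

lemma imageSubobject_mono {X Y : C} (g : X ⟶ Y) {F G : Subobject X} (h : F ≤ G) :
    imageSubobject (F.arrow ≫ g) ≤ imageSubobject (G.arrow ≫ g) := by
  rw [← Subobject.ofLE_arrow h, Category.assoc]
  exact imageSubobject_comp_le _ _

/-- A subobject of the middle term of a short exact sequence is determined, among those comparable
to it, by its trace on the left term and its image in the right term. -/
lemma eq_of_le_of_exact {S : ShortComplex C} (hS : S.ShortExact) {F G : Subobject S.X₂}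
    (h : F ≤ G)
    (h₁ : (Subobject.pullback S.f).obj G ≤ (Subobject.pullback S.f).obj F)
    (h₂ : imageSubobject (G.arrow ≫ S.g) ≤ imageSubobject (F.arrow ≫ S.g)) : F = G := by
  refine le_antisymm h ?_
  rw [le_iff_factors, factors_iff_comp_cokernel_eq_zero]
  -- The goal is `t = 0`, where `t` has image G/F. By `h₁` it kills the part of `G` coming from
  -- `S.X₁`, so it factors through the image of `G` in `S.X₃`; by `h₂` that is the image of `F`,
  -- where `t` vanishes.
  set t := G.arrow ≫ cokernel.π F.arrow with ht
  have hFt : Subobject.ofLE F G h ≫ t = 0 := by simp [ht]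
  have hk : kernel.ι (G.arrow ≫ S.g) ≫ t = 0 := by
    have hx : (kernel.ι (G.arrow ≫ S.g) ≫ G.arrow) ≫ S.g = 0 := by simp
    have := hS.mono_f
    obtain ⟨l, hl⟩ : ∃ l, l ≫ S.f = kernel.ι (G.arrow ≫ S.g) ≫ G.arrow :=
      ⟨hS.exact.lift _ hx, hS.exact.lift_f _ hx⟩
    have hp := Subobject.isPullback S.f G
    have hq := Subobject.isPullback S.f F
    let m := hp.lift (kernel.ι (G.arrow ≫ S.g)) l hl.symm
    have hm : m ≫ ((Subobject.pullback S.f).obj G).arrow = l := hp.lift_snd _ _ _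
    rw [ht, ← Category.assoc, ← hl, ← hm, ← Subobject.ofLE_arrow h₁]
    simp only [Category.assoc]
    rw [← reassoc_of% hq.w]
    simp
  let e := factorThruImageSubobject (G.arrow ≫ S.g)
  obtain ⟨t', ht'⟩ : ∃ t', e ≫ t' = t := by
    have hk' : kernel.ι e ≫ t = 0 := by
      have : kernel.ι e ≫ (G.arrow ≫ S.g) = 0 := by
        have he : e ≫ (imageSubobject (G.arrow ≫ S.g)).arrow = G.arrow ≫ S.g :=
          imageSubobject_arrow_comp _
        exact (kernel.ι e ≫= he).symm.trans (by rw [kernel.condition_assoc, zero_comp])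
      rw [← kernel.lift_ι (G.arrow ≫ S.g) (kernel.ι e) this, Category.assoc, hk, comp_zero]
    exact ⟨Abelian.epiDesc e t hk', Abelian.comp_epiDesc _ _ _⟩
  have h0 : factorThruImageSubobject (F.arrow ≫ S.g) ≫
      Subobject.ofLE _ _ (imageSubobject_mono S.g h) = Subobject.ofLE F G h ≫ e := by
    rw [← cancel_mono (imageSubobject (G.arrow ≫ S.g)).arrow]
    simp [e]
  have hI : imageSubobject (F.arrow ≫ S.g) = imageSubobject (G.arrow ≫ S.g) :=
    le_antisymm (imageSubobject_mono S.g h) h₂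
  have : IsIso (Subobject.ofLE _ _ (imageSubobject_mono S.g h)) :=
    ⟨Subobject.ofLE _ _ hI.ge, by simp, by simp⟩
  have : t' = 0 := by
    rw [← cancel_epi (factorThruImageSubobject (F.arrow ≫ S.g) ≫
      Subobject.ofLE _ _ (imageSubobject_mono S.g h)), h0, Category.assoc, ht', hFt, comp_zero]
  rw [← ht', this, comp_zero]

/-- The pair (trace, image) is strictly monotone in the subobject, and a product of two orders with
the ascending chain condition has it too. -/
lemma isNoetherianObject_of_shortExact {S : ShortComplex C} (hS : S.ShortExact)
    [IsNoetherianObject S.X₁] [IsNoetherianObject S.X₃] : IsNoetherianObject S.X₂ := by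
  refine ⟨StrictMono.wellFoundedGT (f := fun F : Subobject S.X₂ =>
    ((Subobject.pullback S.f).obj F, imageSubobject (F.arrow ≫ S.g))) ?_⟩
  intro F G h
  refine lt_iff_le_not_ge.2 ⟨⟨(Subobject.pullback S.f).monotone h.le,
    imageSubobject_mono S.g h.le⟩, fun h' => h.ne (eq_of_le_of_exact hS h.le h'.1 h'.2)⟩

instance isNoetherianObject_biprod (X Y : C) [IsNoetherianObject X] [IsNoetherianObject Y] :
    IsNoetherianObject (X ⊞ Y) :=
  isNoetherianObject_of_shortExact (S := ShortComplex.mk (biprod.inl : X ⟶ X ⊞ Y) biprod.snd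
    (by simp)) (ShortComplex.Splitting.ofHasBinaryBiproduct X Y).shortExact

end Noetherian

/-! ### Noetherian subobjects in a locally noetherian category. -/

section LocallyNoetherian

variable {C : Type u} [Category.{v} C] [Abelian C]

lemma IsLocallyNoetherian.exists_comp_ne_zero (hC : IsLocallyNoetherian C) {X Y : C} {f : X ⟶ Y}
    (hf : f ≠ 0) : ∃ (P : C) (_ : IsNoetherianObject P) (g : P ⟶ X), g ≫ f ≠ 0 := by
  obtain ⟨Q, -, hQ, hsep⟩ := hC
  by_contra! h
  refine hf (hsep _ _ fun P hP g => ?_)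
  rw [h P ((ObjectProperty.is_iff _ _).2 (hQ _ hP)) g, comp_zero]

lemma IsLocallyNoetherian.exists_noetherian_subobject (hC : IsLocallyNoetherian C) {X : C}
    (hX : ¬ IsZero X) : ∃ (P : C) (i : P ⟶ X), Mono i ∧ IsNoetherianObject P ∧ ¬ IsZero P := by
  obtain ⟨P, hP, g, hg⟩ := hC.exists_comp_ne_zero (f := 𝟙 X) (by rwa [Ne, ← IsZero.iff_id_eq_zero])
  refine ⟨_, image.ι g, inferInstance, isNoetherianObject_of_epi (factorThruImage g), fun h => ?_⟩
  apply hg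
  rw [Category.comp_id, ← image.fac g, h.eq_of_src (image.ι g) 0, comp_zero]

/-- Over a locally noetherian category, an epimorphism onto a noetherian object stays an
epimorphism on some noetherian subobject of its source. -/
lemma IsLocallyNoetherian.exists_noetherian_epi (hC : IsLocallyNoetherian C) {B N : C}
    (p : B ⟶ N) [Epi p] [IsNoetherianObject N] :
    ∃ (B' : C) (j : B' ⟶ B), Mono j ∧ IsNoetherianObject B' ∧ Epi (j ≫ p) := by
  -- A maximal image in `N` of a noetherian object over `B` must be everything: otherwise a map `g`
  -- from a noetherian generator escapes it, and `biprod.desc q g` has a larger image.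
  let s : Set (Subobject N) :=
    {J | ∃ (Q : C) (_ : IsNoetherianObject Q) (q : Q ⟶ B), J = imageSubobject (q ≫ p)}
  have hs : s.Nonempty := ⟨_, _, isNoetherianObject_of_isZero (isZero_zero C), 0, rfl⟩
  obtain ⟨J, ⟨Q, hQ, q, rfl⟩, hJ⟩ := wellFounded_gt.has_min s hs
  have htop : imageSubobject (q ≫ p) = ⊤ := by
    by_contra hne
    have h1 : p ≫ cokernel.π (imageSubobject (q ≫ p)).arrow ≠ 0 := by
      intro h0
      apply hne
      have : Epi (imageSubobject (q ≫ p)).arrow := by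
        apply Preadditive.epi_of_cokernel_zero
        rw [← cancel_epi p, h0, comp_zero]
      have := isIso_of_mono_of_epi (imageSubobject (q ≫ p)).arrow
      exact Subobject.eq_top_of_isIso_arrow _
    obtain ⟨P, hP, g, hg⟩ := hC.exists_comp_ne_zero h1
    refine hJ (imageSubobject (biprod.desc q g ≫ p)) ⟨_, inferInstance, _, rfl⟩ ?_
    refine lt_iff_le_not_ge.2 ⟨?_, fun hle => hg ?_⟩
    · have : q ≫ p = biprod.inl ≫ biprod.desc q g ≫ p := by simp
      rw [this]
      exact imageSubobject_comp_le _ _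
    · have : (imageSubobject (q ≫ p)).Factors (g ≫ p) := by
        refine Subobject.factors_of_le _ hle ?_
        have : g ≫ p = biprod.inr ≫ factorThruImageSubobject (biprod.desc q g ≫ p) ≫
          (imageSubobject (biprod.desc q g ≫ p)).arrow := by simp
        rw [this]
        exact Subobject.factors_of_factors_right _ (Subobject.factors_of_factors_right _
          (Subobject.factors_self _))
      rw [factors_iff_comp_cokernel_eq_zero, Category.assoc] at this
      exact this
  have hqp : Epi (q ≫ p) := by
    rw [← imageSubobject_arrow_comp (q ≫ p)]
    have := (Subobject.isIso_arrow_iff_eq_top _).2 htop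
    infer_instance
  refine ⟨_, image.ι q, inferInstance, isNoetherianObject_of_epi (factorThruImage q), ?_⟩
  refine epi_of_epi_fac (f := factorThruImage q) (h := q ≫ p) ?_
  simp

end LocallyNoetherian

/-! ### Noetherian objects under Serre localization. -/

section Localization

variable {C : Type u} [Category.{v} C] [Abelian C]

open ObjectProperty.SerreClassLocalization in
/-- The localization at a Serre class preserves noetherian objects. -/
lemma isNoetherianObject_localization {D : Type*} [Category D] [Preadditive D]
    (P : ObjectProperty C) [P.IsSerreClass] (L : C ⥤ D) [L.IsLocalization P.isoModSerre]
    [L.Additive] (B : C) [IsNoetherianObject B] : IsNoetherianObject (L.obj B) := by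
  let _ : Abelian D := abelian L P
  have := preservesEpimorphisms L P
  have := Localization.essSurj L P.isoModSerre
  -- These are the `U` whose localization lands in `T`. The noetherian condition and closure under
  -- sums give a largest one, `φ T`; strict monotonicity of `φ` carries the chain condition over.
  let good (T : Subobject (L.obj B)) : Set (Subobject B) :=
    {U | L.map U.arrow ≫ cokernel.π T.arrow = 0}
  have himage (T : Subobject (L.obj B)) {Z : C} (f : Z ⟶ B)
      (hf : L.map f ≫ cokernel.π T.arrow = 0) : imageSubobject f ∈ good T := by
    change _ = _
    rw [← cancel_epi (L.map (factorThruImageSubobject f)), ← Category.assoc, ← L.map_comp,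
      imageSubobject_arrow_comp, hf, comp_zero]
  have hgreatest (T : Subobject (L.obj B)) : ∃ U, IsGreatest (good T) U := by
    have hne : (good T).Nonempty := ⟨imageSubobject (0 : B ⟶ B), himage T 0 (by simp)⟩
    obtain ⟨U, hU, hmax⟩ := wellFounded_gt.has_min (good T) hne
    refine ⟨U, hU, fun V hV => ?_⟩
    have hW : imageSubobject (biprod.desc U.arrow V.arrow) ∈ good T := by
      apply himage
      rw [biprod.desc_eq, L.map_add, L.map_comp, L.map_comp, Preadditive.add_comp,
        Category.assoc, Category.assoc, show _ = _ from hU, show _ = _ from hV]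
      simp
    have hUW : U ≤ imageSubobject (biprod.desc U.arrow V.arrow) :=
      Subobject.le_of_comm (biprod.inl ≫ factorThruImageSubobject _) (by simp)
    have hVW : V ≤ imageSubobject (biprod.desc U.arrow V.arrow) :=
      Subobject.le_of_comm (biprod.inr ≫ factorThruImageSubobject _) (by simp)
    rcases hUW.lt_or_eq with h | h
    · exact (hmax _ hW h).elim
    · exact h ▸ hVW
  choose φ hφ using hgreatest
  have hmono : Monotone φ := fun T T' h => (hφ T').2 (by
    have h1 : T'.Factors (L.map (φ T).arrow) := Subobject.factors_of_le _ h
      ((factors_iff_comp_cokernel_eq_zero _ _).2 (hφ T).1)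
    exact (factors_iff_comp_cokernel_eq_zero _ _).1 h1)
  refine ⟨StrictMono.wellFoundedGT (f := φ) (hmono.strictMono_of_injective ?_)⟩
  suffices ∀ T T', φ T = φ T' → T' ≤ T from fun T T' h => le_antisymm (this _ _ h.symm) (this _ _ h)
  intro T T' h
  -- Up to an inverted denominator, the inclusion of `T'` comes from a morphism `r.f` of `C`. Its
  -- image is good for `T'`, hence lies in `φ T' = φ T`, which localizes into `T`.
  obtain ⟨r, hr⟩ := Localization.exists_rightFraction L P.isoModSerre
    ((L.objObjPreimageIso (T' : D)).hom ≫ T'.arrow)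
  rw [← cancel_epi (L.map r.s), MorphismProperty.RightFraction.map_s_comp_map] at hr
  have := Localization.inverts L P.isoModSerre _ r.hs
  have h1 : L.map r.f ≫ cokernel.π T'.arrow = 0 := by
    rw [← hr]; simp
  have h2 : imageSubobject r.f ≤ φ T := h ▸ (hφ T').2 (himage T' r.f h1)
  rw [le_iff_factors, factors_iff_comp_cokernel_eq_zero,
    ← cancel_epi (L.map r.s ≫ (L.objObjPreimageIso (T' : D)).hom)]
  rw [Category.assoc, ← Category.assoc (L.objObjPreimageIso (T' : D)).hom, ← Category.assoc, hr,
    comp_zero, ← imageSubobject_arrow_comp r.f, ← Subobject.ofLE_arrow h2, L.map_comp, L.map_comp,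
    Category.assoc, Category.assoc, show _ = _ from (hφ T).1]
  simp

end Localization

/-! ### Essential monomorphisms, uniform objects, uniqueness of hulls. -/

section Essential

variable {C : Type u} [Category.{v} C]

/-- A morphism `f` is essential if a morphism is a monomorphism as soon as its composition with
`f` is one. -/
def IsEssential {A B : C} (f : A ⟶ B) : Prop :=
  ∀ ⦃X : C⦄ (g : B ⟶ X), Mono (f ≫ g) → Mono g

lemma IsEssential.comp {A B D : C} {f : A ⟶ B} {g : B ⟶ D} (hf : IsEssential f)
    (hg : IsEssential g) : IsEssential (f ≫ g) := fun X h hm =>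
  hg h (hf _ (by rwa [← Category.assoc]))

lemma IsEssential.of_comp_iso {A B D : C} {f : A ⟶ B} {g : B ⟶ D} [IsIso g]
    (h : IsEssential (f ≫ g)) : IsEssential f := fun X k hm => by
  have := h (inv g ≫ k) (by simpa using hm)
  simpa using mono_comp g (inv g ≫ k)

lemma isEssential_of_comp {A B D : C} {f : A ⟶ B} {g : B ⟶ D} [Mono f]
    (h : IsEssential (f ≫ g)) : IsEssential g := fun X k hm =>
  h k (by rw [Category.assoc]; exact mono_comp _ _)

variable [Abelian C]

lemma isEssential_iff {A B : C} (f : A ⟶ B) [Mono f] :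
    IsEssential f ↔ ∀ L : Subobject B, L ≠ ⊥ → L ⊓ Subobject.mk f ≠ ⊥ := by
  constructor
  · intro h L hL hL'
    refine hL ?_
    have hm : Mono (f ≫ cokernel.π L.arrow) := by
      refine Preadditive.mono_of_cancel_zero _ fun {Z} y hy => ?_
      have h1 : L.Factors (y ≫ f) := by
        rwa [factors_iff_comp_cokernel_eq_zero, Category.assoc]
      have h2 : (L ⊓ Subobject.mk f).Factors (y ≫ f) :=
        (Subobject.inf_factors _).2 ⟨h1, Subobject.mk_factors_iff _ _ |>.2 ⟨y, rfl⟩⟩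
      rw [hL', Subobject.bot_factors_iff_zero] at h2
      rwa [← cancel_mono f, zero_comp]
    have := h _ hm
    rw [← Subobject.mk_arrow L, Subobject.mk_eq_bot_iff_zero, ← cancel_mono (cokernel.π L.arrow),
      cokernel.condition, zero_comp]
  · intro h X g hg
    by_contra hng
    have hk : kernelSubobject g ≠ ⊥ := by
      intro h0
      apply hng
      apply Preadditive.mono_of_kernel_zero
      rwa [← Subobject.mk_eq_bot_iff_zero]
    refine h _ hk ?_
    set K := kernelSubobject g ⊓ Subobject.mk f
    have h1 : K.arrow ≫ g = 0 := by
      rw [← kernelSubobject_factors_iff]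
      exact Subobject.inf_arrow_factors_left _ _
    have h2 : (Subobject.mk f).Factors K.arrow := Subobject.inf_arrow_factors_right _ _
    obtain ⟨y, hy⟩ := (Subobject.mk_factors_iff _ _).1 h2
    have hy0 : y = 0 := (cancel_mono (f ≫ g)).1
      (((Category.assoc y f g).symm.trans (hy =≫ g)).trans (h1.trans zero_comp.symm))
    rw [← Subobject.mk_arrow K, Subobject.mk_eq_bot_iff_zero, ← hy, hy0]
    exact zero_comp

lemma isInjectiveHull_iff (N E : C) :
    IsInjectiveHull N E ↔ Injective E ∧ ∃ ι : N ⟶ E, Mono ι ∧ IsEssential ι := by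
  constructor
  · rintro ⟨hE, ι, hι, h⟩
    exact ⟨hE, ι, hι, (isEssential_iff ι).2 h⟩
  · rintro ⟨hE, ι, hι, h⟩
    exact ⟨hE, ι, hι, (isEssential_iff ι).1 h⟩

lemma IsInjectiveHull.of_iso {N E E' : C} (h : IsInjectiveHull N E) (e : E ≅ E') :
    IsInjectiveHull N E' := by
  rw [isInjectiveHull_iff] at h ⊢
  obtain ⟨hE, ι, hι, h⟩ := h
  refine ⟨Injective.of_iso e hE, ι ≫ e.hom, mono_comp _ _, ?_⟩
  refine IsEssential.of_comp_iso (g := e.inv) ?_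
  simpa using h

lemma IsInjectiveHull.of_isEssential {L N E : C} (h : IsInjectiveHull N E) (f : L ⟶ N) [Mono f]
    (hf : IsEssential f) : IsInjectiveHull L E := by
  rw [isInjectiveHull_iff] at h ⊢
  obtain ⟨hE, ι, hι, h⟩ := h
  exact ⟨hE, f ≫ ι, mono_comp _ _, hf.comp h⟩

/-- A monomorphism from an object into an injective one extends to its injective hull. -/
lemma IsInjectiveHull.exists_mono {N E I : C} (h : IsInjectiveHull N E) [Injective I]
    (f : N ⟶ I) [Mono f] : ∃ g : E ⟶ I, Mono g := by
  obtain ⟨-, ι, hι, h⟩ := (isInjectiveHull_iff _ _).1 h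
  exact ⟨Injective.factorThru f ι, h _ (by rwa [Injective.comp_factorThru])⟩

lemma mono_injective_splits {E I : C} [Injective E] (g : E ⟶ I) [Mono g] :
    Nonempty (I ≅ E ⊞ cokernel g) := by
  have hS : (ShortComplex.mk g (cokernel.π g) (cokernel.condition g)).ShortExact :=
    { exact := ShortComplex.exact_cokernel g }
  let r := Injective.factorThru (𝟙 E) g
  exact ⟨(ShortComplex.Splitting.ofExactOfRetraction _ hS.exact r
    (Injective.comp_factorThru _ _) hS.epi_g).isoBinaryBiproduct⟩

/-- The hull embeds in `I` as a direct summand, nonzero because it contains `N`, so its complement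
vanishes. -/
lemma IsInjectiveHull.iso_of_indecomposable {N E I : C} (h : IsInjectiveHull N E)
    (hN : ¬ IsZero N) [Injective I] (hI : Indecomposable I) (f : N ⟶ I) [Mono f] :
    Nonempty (E ≅ I) := by
  obtain ⟨g, hg⟩ := h.exists_mono f
  have := h.1
  obtain ⟨e⟩ := mono_injective_splits g
  rcases hI.2 _ _ e with h0 | h0
  · obtain ⟨-, ι, hι, -⟩ := h
    refine (hN ?_).elim
    rw [IsZero.iff_id_eq_zero, ← cancel_mono ι]
    exact h0.eq_of_tgt _ _
  · have : Epi g := Preadditive.epi_of_isZero_cokernel g h0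
    have := isIso_of_mono_of_epi g
    exact ⟨asIso g⟩

/-- An object is uniform if two of its nonzero subobjects always meet. -/
def IsUniform (N : C) : Prop :=
  ¬ IsZero N ∧ ∀ ⦃Y Z : C⦄ (f : N ⟶ Y) (g : N ⟶ Z), Mono (biprod.lift f g) → Mono f ∨ Mono g

/-- If `g` is mono on `L`, then `cokernel.π i` and `g` are jointly mono. The first is not mono,
since it kills `L`, so `g` is. -/
lemma IsUniform.isEssential {L N : C} (hN : IsUniform N) (hL : ¬ IsZero L) (i : L ⟶ N) [Mono i] :
    IsEssential i := by
  intro X g hg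
  refine (hN.2 (cokernel.π i) g ?_).resolve_left fun h => hL ?_
  · refine Preadditive.mono_of_cancel_zero _ fun {Z} y hy => ?_
    have h1 : y ≫ cokernel.π i = 0 := by simpa using hy =≫ biprod.fst
    have h2 : y ≫ g = 0 := by simpa using hy =≫ biprod.snd
    rw [← Abelian.monoLift_comp i y h1, Category.assoc] at h2
    rw [← Abelian.monoLift_comp i y h1, (cancel_mono (i ≫ g)).1 (h2.trans zero_comp.symm),
      zero_comp]
  · rw [IsZero.iff_id_eq_zero, ← cancel_mono i, ← cancel_mono (cokernel.π i)]
    simp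

/-- One projection of a decomposition is mono on `N` by uniformity, hence on `E` by essentiality, so
the other summand is zero. -/
lemma IsInjectiveHull.indecomposable {N E : C} (h : IsInjectiveHull N E) (hN : IsUniform N) :
    Indecomposable E := by
  obtain ⟨-, ι, hι, h⟩ := (isInjectiveHull_iff _ _).1 h
  refine ⟨fun h0 => hN.1 ?_, fun Y Z e => ?_⟩
  · rw [IsZero.iff_id_eq_zero, ← cancel_mono ι]
    exact h0.eq_of_tgt _ _
  · have hm : Mono (biprod.lift (ι ≫ e.hom ≫ biprod.fst) (ι ≫ e.hom ≫ biprod.snd)) := by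
      have : biprod.lift (ι ≫ e.hom ≫ biprod.fst) (ι ≫ e.hom ≫ biprod.snd) = ι ≫ e.hom := by
        ext <;> simp
      rw [this]
      infer_instance
    rcases hN.2 _ _ hm with h1 | h1
    · right
      have := h _ h1
      rw [IsZero.iff_id_eq_zero, ← cancel_mono ((biprod.inr : Z ⟶ Y ⊞ Z) ≫ e.inv),
        ← cancel_mono (e.hom ≫ biprod.fst)]
      simp
    · left
      have := h _ h1
      rw [IsZero.iff_id_eq_zero, ← cancel_mono ((biprod.inl : Y ⟶ Y ⊞ Z) ≫ e.inv),
        ← cancel_mono (e.hom ≫ biprod.snd)]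
      simp

lemma IsInjectiveHull.nonempty_iso {N E E' : C} (hN : IsUniform N) (h : IsInjectiveHull N E)
    (h' : IsInjectiveHull N E') : Nonempty (E ≅ E') := by
  have hi := h'.indecomposable hN
  obtain ⟨hE', ι, hι, -⟩ := h'
  exact h.iso_of_indecomposable hN.1 hi ι

end Essential

/-! ### Existence of injective hulls. -/

section InjectiveHull

variable {C : Type u} [Category.{v} C] [Abelian C]

/-- Both conditions say that `A` and `B` meet trivially in `I`. -/
lemma mono_comp_cokernel_symm {A B I : C} {a : A ⟶ I} {b : B ⟶ I} [Mono a] [Mono b]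
    (h : Mono (a ≫ cokernel.π b)) : Mono (b ≫ cokernel.π a) := by
  refine Preadditive.mono_of_cancel_zero _ fun {Z} y hy => ?_
  rw [← Category.assoc] at hy
  have h1 := Abelian.monoLift_comp a (y ≫ b) hy
  have h2 : Abelian.monoLift a (y ≫ b) hy = 0 := by
    rw [← cancel_mono (a ≫ cokernel.π b), zero_comp, ← Category.assoc, h1, Category.assoc,
      cokernel.condition, comp_zero]
  rw [h2, zero_comp] at h1
  rw [← cancel_mono b, ← h1, zero_comp]

variable [IsGrothendieckAbelian.{v} C]

/-- The subobjects that meet a given one trivially are closed under directed unions. -/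
lemma exists_upper_bound_disjoint {A I : C} (a : A ⟶ I) {J : Type v} [Preorder J]
    [IsDirectedOrder J] [Nonempty J] {K : J → Subobject I} (hK : Monotone K)
    (ha : ∀ j, Mono (a ≫ cokernel.π (K j).arrow)) :
    ∃ L : Subobject I, (∀ j, K j ≤ L) ∧ Mono (a ≫ cokernel.π L.arrow) := by
  have hz {i j : J} (h : i ≤ j) : (K i).arrow ≫ cokernel.π (K j).arrow = 0 := by
    rw [← Subobject.ofLE_arrow (hK h), Category.assoc, cokernel.condition, comp_zero]
  -- The quotients I/K_j form a directed system receiving `A` by monomorphisms. Exactness of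
  -- filtered colimits keeps `A` mono into the colimit, and the kernel of `I` into the colimit is
  -- the bound.
  let F : J ⥤ C :=
    { obj := fun j => cokernel (K j).arrow
      map := fun {i j} h => cokernel.desc _ _ (hz (leOfHom h))
      map_id := fun j => by ext; simp
      map_comp := fun f g => by ext; simp }
  let α : (Functor.const J).obj A ⟶ F :=
    { app := fun j => a ≫ cokernel.π (K j).arrow
      naturality := fun i j h => by simp [F] }
  have : ∀ j, Mono (α.app j) := ha
  have : Mono α := NatTrans.mono_of_mono_app α
  have : IsConnected J := IsFiltered.isConnected J
  obtain ⟨j₀⟩ := ‹Nonempty J›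
  let q : I ⟶ colimit F := cokernel.π (K j₀).arrow ≫ colimit.ι F j₀
  have hq (j : J) : cokernel.π (K j).arrow ≫ colimit.ι F j = q := by
    obtain ⟨k, hj, h0⟩ := exists_ge_ge j j₀
    have h1 : cokernel.π (K j).arrow ≫ F.map (homOfLE hj) = cokernel.π (K k).arrow := by simp [F]
    have h2 : cokernel.π (K j₀).arrow ≫ F.map (homOfLE h0) = cokernel.π (K k).arrow := by simp [F]
    change _ = cokernel.π (K j₀).arrow ≫ colimit.ι F j₀
    rw [← colimit.w F (homOfLE hj), ← colimit.w F (homOfLE h0), reassoc_of% h1, reassoc_of% h2]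
  have hm : Mono (a ≫ q) :=
    colim.map_mono' α (isColimitConstCocone J A) (colimit.isColimit F) (a ≫ q)
      (fun j => (Category.id_comp _).trans
        ((a ≫= (hq j)).symm.trans (Category.assoc _ _ _).symm))
  refine ⟨kernelSubobject q, fun j => ?_, ?_⟩
  · rw [le_iff_factors, kernelSubobject_factors_iff, ← hq j, cokernel.condition_assoc, zero_comp]
  · have h1 : (a ≫ cokernel.π (kernelSubobject q).arrow) ≫
        cokernel.desc _ q (kernelSubobject_arrow_comp q) = a ≫ q := by simp
    exact mono_of_mono_fac h1

lemma exists_maximal_disjoint {A I : C} (a : A ⟶ I) (K₀ : Subobject I)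
    (h₀ : Mono (a ≫ cokernel.π K₀.arrow)) :
    ∃ K : Subobject I, K₀ ≤ K ∧ Maximal (fun K => Mono (a ≫ cokernel.π K.arrow)) K :=
  zorn_le_nonempty₀ {K : Subobject I | Mono (a ≫ cokernel.π K.arrow)}
    (fun c hc hchain y hy => by
      -- Well-poweredness lets the chain be indexed in universe `v`, where filtered colimits are
      -- exact.
      have : Nonempty (Shrink.{v} c) := ⟨equivShrink c ⟨y, hy⟩⟩
      have : IsDirectedOrder (Shrink.{v} c) := ⟨fun i j => by
        rcases hchain.total ((orderIsoShrink c).symm i).2 ((orderIsoShrink c).symm j).2 with h | h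
        · exact ⟨j, (orderIsoShrink c).symm.le_iff_le.1 h, le_rfl⟩
        · exact ⟨i, le_rfl, (orderIsoShrink c).symm.le_iff_le.1 h⟩⟩
      obtain ⟨K, hK, hm⟩ := exists_upper_bound_disjoint a
        (K := fun j : Shrink.{v} c => ((orderIsoShrink c).symm j : Subobject I))
        (fun _ _ h => (orderIsoShrink c).symm.monotone h)
        (fun j => hc ((orderIsoShrink c).symm j).2)
      exact ⟨K, hm, fun z hz => by simpa using hK (orderIsoShrink c ⟨z, hz⟩)⟩) K₀ h₀

/-- If `g` is mono on `A`, the kernel of I → I/K → X contains `K` and still misses `A`; by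
maximality it is `K`. -/
lemma isEssential_of_maximal_disjoint {A I : C} (a : A ⟶ I) {K : Subobject I}
    (hK : Maximal (fun K => Mono (a ≫ cokernel.π K.arrow)) K) :
    IsEssential (a ≫ cokernel.π K.arrow) := by
  intro X g hg
  set q := cokernel.π K.arrow ≫ g with hq
  have hle : K ≤ kernelSubobject q := by
    rw [le_iff_factors, kernelSubobject_factors_iff, hq, cokernel.condition_assoc, zero_comp]
  have hm : Mono (a ≫ cokernel.π (kernelSubobject q).arrow) := by
    have h1 : (a ≫ cokernel.π (kernelSubobject q).arrow) ≫
        cokernel.desc _ q (kernelSubobject_arrow_comp q) = (a ≫ cokernel.π K.arrow) ≫ g := by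
      simp [hq]
    exact mono_of_mono_fac h1
  have hge : kernelSubobject q ≤ K := hK.2 hm hle
  refine Preadditive.mono_of_cancel_zero _ fun {Z} y hy => ?_
  have hp := IsPullback.of_hasPullback y (cokernel.π K.arrow)
  have h1 : pullback.snd y (cokernel.π K.arrow) ≫ q = 0 := by
    rw [hq, ← pullback.condition_assoc, hy, comp_zero]
  have h2 : K.Factors (pullback.snd y (cokernel.π K.arrow)) :=
    Subobject.factors_of_le _ hge ((kernelSubobject_factors_iff _ _).2 h1)
  rw [factors_iff_comp_cokernel_eq_zero, ← pullback.condition] at h2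
  rw [← cancel_epi (pullback.fst y (cokernel.π K.arrow)), h2, comp_zero]

/-- Every object of a Grothendieck category has an injective hull. -/
lemma exists_isInjectiveHull (N : C) : ∃ E : C, IsInjectiveHull N E := by
  let I := Injective.under N
  let a : N ⟶ I := Injective.ι N
  have hbot : Mono (a ≫ cokernel.π (⊥ : Subobject I).arrow) := by
    have : Mono (cokernel.π (⊥ : Subobject I).arrow) := by
      refine Preadditive.mono_of_cancel_zero _ fun {Z} y hy => ?_
      rwa [← factors_iff_comp_cokernel_eq_zero, Subobject.bot_factors_iff_zero] at hy
    exact mono_comp _ _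
  -- The hull is I/K. To see it is injective, choose `E ≥ N` maximal among subobjects missing `K`;
  -- extending the inclusion of `E` along E → I/K gives `r : I/K ⟶ I`, which turns out to be a
  -- section of `q`.
  obtain ⟨K, -, hK⟩ := exists_maximal_disjoint a ⊥ hbot
  have hess := isEssential_of_maximal_disjoint a hK
  set q := cokernel.π K.arrow with hq
  have hmq : Mono (a ≫ q) := hK.1
  have hmk : Mono (K.arrow ≫ cokernel.π (Subobject.mk a).arrow) := by
    apply mono_comp_cokernel_symm
    have : (Subobject.mk a).arrow = (Subobject.underlyingIso a).hom ≫ a := by simp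
    rw [this, Category.assoc]
    exact mono_comp _ _
  obtain ⟨E, haE, hE⟩ := exists_maximal_disjoint K.arrow (Subobject.mk a) hmk
  have : Mono (E.arrow ≫ q) := mono_comp_cokernel_symm hE.1
  have haE' : E.Factors a := Subobject.factors_of_le _ haE (Subobject.mk_factors_self a)
  have hessE : IsEssential (E.arrow ≫ q) := by
    have : Mono (E.factorThru a haE') := mono_of_mono_fac (E.factorThru_arrow a haE')
    refine isEssential_of_comp (f := E.factorThru a haE') ?_
    rwa [← Category.assoc, E.factorThru_arrow]
  let r : cokernel K.arrow ⟶ I := Injective.factorThru E.arrow (E.arrow ≫ q)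
  have hr : (E.arrow ≫ q) ≫ r = E.arrow := Injective.comp_factorThru _ _
  have : Mono r := hessE _ (by rw [hr]; infer_instance)
  have hrq : Mono (r ≫ q) := hessE _ (by rw [← Category.assoc, hr]; infer_instance)
  have hEr : E ≤ Subobject.mk r := Subobject.le_mk_of_comm (E.arrow ≫ q) hr
  -- The image of `r` also misses `K`, so maximality of `E` forces it into `E`.
  have hrE : Subobject.mk r ≤ E := by
    refine hE.2 ?_ hEr
    apply mono_comp_cokernel_symm
    have : (Subobject.mk r).arrow = (Subobject.underlyingIso r).hom ≫ r := by simp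
    rw [this, Category.assoc]
    exact mono_comp _ _
  have hrE' : E.Factors r := Subobject.factors_of_le _ hrE (Subobject.mk_factors_self r)
  have hs : r ≫ q ≫ r = r := by
    have h1 : E.factorThru r hrE' ≫ (E.arrow ≫ q) ≫ r = r := by rw [hr, E.factorThru_arrow]
    rwa [Category.assoc, ← Category.assoc, E.factorThru_arrow] at h1
  have hrq1 : r ≫ q = 𝟙 _ := by
    rw [← cancel_mono r, Category.assoc, hs, Category.id_comp]
  refine ⟨cokernel K.arrow, (isInjectiveHull_iff _ _).2 ⟨?_, a ≫ q, hmq, hess⟩⟩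
  exact Retract.injective ⟨r, q, hrq1⟩

end InjectiveHull

/-! ### Critical modules and their existence. -/

section Critical

variable {C : Type u} [Category.{v} C] [Abelian C]

lemma not_isZero_of_mono {X Y : C} (f : X ⟶ Y) [Mono f] (hX : ¬ IsZero X) : ¬ IsZero Y :=
  fun h => hX (by rw [IsZero.iff_id_eq_zero, ← cancel_mono f]; exact h.eq_of_tgt _ _)

lemma not_isZero_pullback {X Y Z : C} {f : X ⟶ Z} {g : Y ⟶ Z} [Mono g] (hX : ¬ IsZero X)
    [Mono f] (h : IsEssential g) : ¬ IsZero (pullback f g) := by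
  intro h0
  apply hX
  have hm : Mono (g ≫ cokernel.π f) := by
    refine Preadditive.mono_of_cancel_zero _ fun {W} y hy => ?_
    rw [← Category.assoc] at hy
    have h1 := Abelian.monoLift_comp f (y ≫ g) hy
    rw [← pullback.lift_snd _ _ h1, h0.eq_of_src (pullback.snd f g) 0, comp_zero]
  have := h _ hm
  rw [IsZero.iff_id_eq_zero, ← cancel_mono (f ≫ cokernel.π f)]
  simp

namespace DimensionFunction

variable (δ : DimensionFunction.{w} C)

lemma dim_eq_of_mono {X Y : C} (f : X ⟶ Y) [Mono f] :
    δ.dim Y = max (δ.dim X) (δ.dim (cokernel f)) :=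
  δ.exact (ShortComplex.mk f (cokernel.π f) (cokernel.condition f))
    { exact := ShortComplex.exact_cokernel f }

lemma dim_le_of_mono {X Y : C} (f : X ⟶ Y) [Mono f] : δ.dim X ≤ δ.dim Y :=
  δ.dim_eq_of_mono f ▸ le_max_left _ _

lemma dim_le_of_epi {X Y : C} (f : X ⟶ Y) [Epi f] : δ.dim Y ≤ δ.dim X := by
  have h := δ.exact (ShortComplex.mk (kernel.ι f) f (kernel.condition f))
    { exact := ShortComplex.exact_kernel f }
  exact h ▸ le_max_right _ _

lemma dim_eq_of_iso {X Y : C} (e : X ≅ Y) : δ.dim X = δ.dim Y :=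
  le_antisymm (δ.dim_le_of_mono e.hom) (δ.dim_le_of_mono e.inv)

lemma dim_biprod (X Y : C) : δ.dim (X ⊞ Y) = max (δ.dim X) (δ.dim Y) :=
  δ.exact (ShortComplex.mk (biprod.inl : X ⟶ X ⊞ Y) biprod.snd (by simp))
    (ShortComplex.Splitting.ofHasBinaryBiproduct X Y).shortExact

variable {δ} {α : Ordinal.{w}}

lemma isCriticalOf_iff {M : C} : δ.IsCriticalOf α M ↔ δ.dim M = α ∧
    ∀ ⦃Y : C⦄ (p : M ⟶ Y) [Epi p], ¬ Mono p → δ.dim Y < α := by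
  refine and_congr_right fun _ => ⟨fun h Y p _ hp => ?_, fun h N hN => h (cokernel.π N.arrow) fun hm => hN ?_⟩
  · have hk : kernelSubobject p ≠ ⊥ := fun h0 => hp <| by
      apply Preadditive.mono_of_kernel_zero
      rwa [← Subobject.mk_eq_bot_iff_zero]
    refine lt_of_le_of_lt ?_ (h _ hk)
    have : Epi (cokernel.desc _ p (kernelSubobject_arrow_comp p)) :=
      epi_of_epi_fac (cokernel.π_desc _ p (kernelSubobject_arrow_comp p))
    exact δ.dim_le_of_epi (cokernel.desc _ p (kernelSubobject_arrow_comp p))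
  · rw [← Subobject.mk_arrow N, Subobject.mk_eq_bot_iff_zero, ← cancel_mono (cokernel.π N.arrow),
      cokernel.condition, zero_comp]

lemma IsCriticalOf.not_isZero {M : C} (h : δ.IsCriticalOf α M) : ¬ IsZero M := fun h0 => by
  rw [← δ.dim_eq_bot_iff, h.1] at h0
  exact WithBot.coe_ne_bot h0

lemma IsCritical.not_isZero {M : C} (h : δ.IsCritical M) : ¬ IsZero M :=
  h.elim fun _ h => h.not_isZero

lemma IsCriticalOf.dim_cokernel_lt {M L : C} (h : δ.IsCriticalOf α M) (i : L ⟶ M)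
    (hL : ¬ IsZero L) [Mono i] : δ.dim (cokernel i) < α := by
  refine (isCriticalOf_iff.1 h).2 (cokernel.π i) fun hm => hL ?_
  rw [IsZero.iff_id_eq_zero, ← cancel_mono i, ← cancel_mono (cokernel.π i)]
  simp

lemma IsCriticalOf.dim_eq_of_mono {M L : C} (h : δ.IsCriticalOf α M) (i : L ⟶ M) [Mono i]
    (hL : ¬ IsZero L) : δ.dim L = α := by
  have h1 := δ.dim_eq_of_mono i
  have h2 := h.dim_cokernel_lt i hL
  rw [h.1] at h1
  rcases max_choice (δ.dim L) (δ.dim (cokernel i)) with h3 | h3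
  · rw [h1, h3]
  · rw [h1, h3] at h2
    exact (lt_irrefl _ h2).elim

/-- By pushout, a proper quotient of `L` embeds in a proper quotient of `M`. -/
lemma IsCriticalOf.of_mono {M L : C} (h : δ.IsCriticalOf α M) (i : L ⟶ M) [Mono i]
    (hL : ¬ IsZero L) : δ.IsCriticalOf α L := by
  refine isCriticalOf_iff.2 ⟨h.dim_eq_of_mono i hL, fun Y p _ hp => ?_⟩
  refine lt_of_le_of_lt (δ.dim_le_of_mono (pushout.inr i p)) ?_
  refine (isCriticalOf_iff.1 h).2 (pushout.inl i p) fun hm => hp ?_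
  have : Mono (p ≫ pushout.inr i p) := by
    rw [← pushout.condition]
    exact mono_comp _ _
  exact mono_of_mono p (pushout.inr i p)

lemma IsCritical.of_mono {M L : C} (h : δ.IsCritical M) (i : L ⟶ M) [Mono i]
    (hL : ¬ IsZero L) : δ.IsCritical L :=
  h.imp fun _ h => h.of_mono i hL

/-- A nonzero morphism from an `α`-critical object to an `α`-critical one is a monomorphism. -/
lemma IsCriticalOf.mono_of_ne_zero {M N : C} (hM : δ.IsCriticalOf α M) (hN : δ.IsCriticalOf α N)
    (f : M ⟶ N) (hf : f ≠ 0) : Mono f := by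
  have hi : ¬ IsZero (image f) := fun h => hf (by
    rw [← image.fac f, h.eq_of_src (image.ι f) 0, comp_zero])
  by_contra hm
  have h1 : ¬ Mono (factorThruImage f) := fun h => hm (by
    rw [← image.fac f]
    exact mono_comp _ _)
  have h2 := (isCriticalOf_iff.1 hM).2 (factorThruImage f) h1
  rw [hN.dim_eq_of_mono (image.ι f) hi] at h2
  exact lt_irrefl _ h2

/-- If neither `f` nor `g` were mono, `M` would embed in a sum of two proper quotients, of dimension
below that of `M`. -/
lemma IsCritical.isUniform {M : C} (h : δ.IsCritical M) : IsUniform M := by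
  obtain ⟨α, h⟩ := h
  refine ⟨h.not_isZero, fun Y Z f g hm => ?_⟩
  by_contra! hfg
  have key {W : C} (k : M ⟶ W) (hk : ¬ Mono k) : δ.dim (image k) < α :=
    (isCriticalOf_iff.1 h).2 (factorThruImage k) fun h => hk (by
      rw [← image.fac k]
      exact mono_comp _ _)
  have : Mono (biprod.lift (factorThruImage f) (factorThruImage g)) := by
    have h1 : biprod.lift (factorThruImage f) (factorThruImage g) ≫
        biprod.map (image.ι f) (image.ι g) = biprod.lift f g := by
      ext <;> simp
    exact mono_of_mono_fac h1
  have h2 := δ.dim_le_of_mono (biprod.lift (factorThruImage f) (factorThruImage g))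
  rw [δ.dim_biprod, h.1] at h2
  exact (max_lt (key f hfg.1) (key g hfg.2)).not_ge h2

/-- A nonzero noetherian object contains a critical one. -/
lemma exists_isCritical_of_noetherian (δ : DimensionFunction.{w} C) (M : C)
    [IsNoetherianObject M] (hM : ¬ IsZero M) :
    ∃ (N : C) (i : N ⟶ M), Mono i ∧ δ.IsCritical N := by
  let s : Set (WithBot Ordinal.{w}) := {d | ∃ (N : C) (i : N ⟶ M), Mono i ∧ ¬ IsZero N ∧
    δ.dim N = d}
  obtain ⟨d, ⟨M₀, i₀, hi₀, hM₀, rfl⟩, hmin⟩ :=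
    wellFounded_lt.has_min s ⟨_, M, 𝟙 M, inferInstance, hM, rfl⟩
  have : IsNoetherianObject M₀ := isNoetherianObject_of_mono i₀
  obtain ⟨α, hα⟩ : ∃ α : Ordinal.{w}, δ.dim M₀ = α := by
    have := mt (δ.dim_eq_bot_iff M₀).1 hM₀
    exact ⟨_, (WithBot.coe_unbot _ this).symm⟩
  by_contra! hcon
  -- By minimality every nonzero `K ≤ M₀` has dimension `α`. Not being critical, it has a nonzero
  -- `P` with K/P not of smaller dimension; in particular `P ≠ K`. Iterating contradicts finite
  -- partitivity at every index.
  have step (K : {K : Subobject M₀ // K ≠ ⊥}) : ∃ P : {K : Subobject M₀ // K ≠ ⊥}, ∃ h : P < K,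
      ¬ δ.dim (cokernel (Subobject.ofLE P.1 K.1 h.le)) < α := by
    obtain ⟨K, hK⟩ := K
    have hK' := (ne_bot_iff_not_isZero K).1 hK
    have hd : δ.dim (K : C) = α := by
      refine le_antisymm (hα ▸ δ.dim_le_of_mono K.arrow) (not_lt.1 fun h => ?_)
      exact hmin _ ⟨(K : C), K.arrow ≫ i₀, mono_comp _ _, hK', rfl⟩ (hα ▸ h)
    have hnc : ¬ δ.IsCriticalOf α (K : C) := fun h =>
      hcon _ (K.arrow ≫ i₀) (mono_comp _ _) ⟨α, h⟩
    simp only [IsCriticalOf, hd, true_and, not_forall] at hnc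
    obtain ⟨P, hP, hPd⟩ := hnc
    have hle : Subobject.mk (P.arrow ≫ K.arrow) ≤ K := Subobject.mk_le_of_comm P.arrow rfl
    have hcomm : (Subobject.underlyingIso (P.arrow ≫ K.arrow)).hom ≫ P.arrow =
        Subobject.ofLE _ K hle := by
      rw [← cancel_mono K.arrow]
      simp
    have hd' : δ.dim (cokernel (Subobject.ofLE _ K hle)) = δ.dim (cokernel P.arrow) := by
      rw [← hcomm]
      exact δ.dim_eq_of_iso (cokernelEpiComp _ _)
    refine ⟨⟨Subobject.mk (P.arrow ≫ K.arrow), fun h0 => hP ?_⟩, lt_of_le_of_ne hle fun he => ?_,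
      hd' ▸ hPd⟩
    · rw [Subobject.mk_eq_bot_iff_zero, ← zero_comp (f := K.arrow), cancel_mono] at h0
      rw [← Subobject.mk_arrow P, Subobject.mk_eq_bot_iff_zero, h0]
    · have he' : Subobject.mk (P.arrow ≫ K.arrow) = K := congrArg Subtype.val he
      have : IsIso (Subobject.ofLE _ K hle) := ⟨Subobject.ofLE _ _ he'.ge, by simp, by simp⟩
      refine hPd ?_
      rw [← hd', (δ.dim_eq_bot_iff _).2 (isZero_cokernel_of_epi _)]
      exact WithBot.bot_lt_coe α
  choose φ hφ hφd using step
  have htop : (⊤ : Subobject M₀) ≠ ⊥ := fun h => by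
    refine (ne_bot_iff_not_isZero (⊤ : Subobject M₀)).2 (fun h0 => hM₀ ?_) h
    exact h0.of_iso (asIso (⊤ : Subobject M₀).arrow).symm
  let N : ℕ → {K : Subobject M₀ // K ≠ ⊥} := fun n => φ^[n] ⟨⊤, htop⟩
  have hN (n : ℕ) : N (n + 1) = φ (N n) := Function.iterate_succ_apply' _ _ _
  have hanti : StrictAnti fun n => (N n).1 := strictAnti_nat_of_succ_lt fun n => by
    rw [hN]
    exact hφ (N n)
  refine Set.infinite_univ (α := ℕ) ((δ.finitely_partitive M₀ inferInstance (fun n => (N n).1)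
    hanti rfl).subset fun n _ => ?_)
  have hd (P : {K : Subobject M₀ // K ≠ ⊥}) (hP : P = φ (N n)) (h : P.1 ≤ (N n).1) :
      ¬ δ.dim (cokernel (Subobject.ofLE P.1 (N n).1 h)) < α := by
    subst hP
    exact hφd (N n)
  change ¬ _ < δ.dim M₀
  rw [hα]
  exact hd _ (hN n) _

lemma exists_isCritical (δ : DimensionFunction.{w} C) (hC : IsLocallyNoetherian C) {M : C}
    (hM : ¬ IsZero M) : ∃ (N : C) (i : N ⟶ M), Mono i ∧ δ.IsCritical N := by
  obtain ⟨P, i, hi, _, hP⟩ := hC.exists_noetherian_subobject hM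
  obtain ⟨N, j, hj, hN⟩ := δ.exists_isCritical_of_noetherian P hP
  exact ⟨N, j ≫ i, mono_comp _ _, hN⟩

end DimensionFunction

end Critical

/-! ### Finite subgeneration and equivalence of critical modules. -/

section Spec

variable {C : Type u} [Category.{v} C] [Abelian C]

lemma FinSubgen.of_mono {L N : C} (i : L ⟶ N) [Mono i] : FinSubgen N L :=
  ⟨1, L, i ≫ biproduct.ι (fun _ : Fin 1 => N) 0, 𝟙 L, mono_comp _ _, inferInstance⟩

lemma isSpecModule_iff {M : C} : IsSpecModule M ↔ ¬ IsZero M ∧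
    ∀ ⦃L : C⦄ (i : L ⟶ M) [Mono i], ¬ IsZero L → FinSubgen L M := by
  refine and_congr_right fun _ => ⟨fun h L i _ hL => ?_, fun h N hN => ?_⟩
  · refine (FinSubgen.of_mono (Subobject.underlyingIso i).hom).trans (h (Subobject.mk i) ?_)
    rw [ne_bot_iff_not_isZero]
    exact not_isZero_of_mono (Subobject.underlyingIso i).inv hL
  · exact h N.arrow ((ne_bot_iff_not_isZero N).1 hN)

lemma IsSpecModule.of_mono {M L : C} (h : IsSpecModule M) (i : L ⟶ M) [Mono i]
    (hL : ¬ IsZero L) : IsSpecModule L :=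
  isSpecModule_iff.2 ⟨hL, fun _ j _ hK =>
    ((isSpecModule_iff.1 h).2 (j ≫ i) hK).trans (FinSubgen.of_mono i)⟩

lemma Spectrum.mk_eq_of_mono {M L : SpecModule C} (i : L.1 ⟶ M.1) [Mono i] :
    Spectrum.mk L = Spectrum.mk M :=
  Quotient.sound ⟨(isSpecModule_iff.1 M.2).2 i L.2.1, FinSubgen.of_mono i⟩

lemma Spectrum.exists_rep (p : Spectrum C) : ∃ M : SpecModule C, Spectrum.mk M = p :=
  Quotient.exists_rep p

/-- A nonzero object that is finitely subgenerated by `Y` receives a nonzero morphism from a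
subobject of `Y`. -/
lemma FinSubgen.exists_ne_zero {Y N : C} (h : FinSubgen Y N) (hN : ¬ IsZero N) :
    ∃ (L : C) (j : L ⟶ Y) (f : L ⟶ N), Mono j ∧ f ≠ 0 := by
  obtain ⟨t, B, i, p, hi, hp⟩ := h
  suffices ∀ (s : Finset (Fin t)) (B : C) (i : B ⟶ ⨁ fun _ : Fin t => Y) (p : B ⟶ N), Mono i →
      p ≠ 0 → (∀ k ∉ s, i ≫ biproduct.π _ k = 0) →
      ∃ (L : C) (j : L ⟶ Y) (f : L ⟶ N), Mono j ∧ f ≠ 0 by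
    refine this Finset.univ B i p hi (fun h0 => hN ?_) (fun k hk => (hk (Finset.mem_univ k)).elim)
    rw [IsZero.iff_id_eq_zero, ← cancel_epi p, h0]
    simp
  intro s
  induction s using Finset.induction_on with
  | empty =>
    intro B i p hi hp h
    have hi0 : i = 0 := biproduct.hom_ext _ _ fun k => by
      rw [h k (Finset.notMem_empty k), zero_comp]
    refine (hp ?_).elim
    rw [← Category.id_comp p, (cancel_mono i).1 (show 𝟙 B ≫ i = 0 ≫ i by simp [hi0]), zero_comp]
  | insert k s hk ih =>
    intro B i p hi hp h
    -- If `p` dies on the kernel of the `k`-th coordinate, it descends to the image of that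
    -- coordinate, a subobject of `Y`. Otherwise that kernel replaces `B`, with one coordinate
    -- fewer.
    by_cases h0 : kernel.ι (i ≫ biproduct.π _ k) ≫ p = 0
    · have h1 : kernel.ι (Abelian.factorThruImage (i ≫ biproduct.π _ k)) ≫ p = 0 := by
        have h2 : kernel.ι (Abelian.factorThruImage (i ≫ biproduct.π _ k)) ≫
            (i ≫ biproduct.π _ k) = 0 := by
          exact (_ ≫= Abelian.image.fac (i ≫ biproduct.π _ k)).symm.trans
            (by rw [kernel.condition_assoc, zero_comp])
        rw [← kernel.lift_ι _ _ h2, Category.assoc, h0, comp_zero]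
      refine ⟨_, Abelian.image.ι (i ≫ biproduct.π _ k),
        Abelian.epiDesc (Abelian.factorThruImage _) p h1, inferInstance, fun h3 => hp ?_⟩
      rw [← Abelian.comp_epiDesc (Abelian.factorThruImage _) p h1, h3, comp_zero]
    · refine ih _ (kernel.ι (i ≫ biproduct.π _ k) ≫ i) _ (mono_comp _ _) h0 fun l hl => ?_
      by_cases hlk : l = k
      · subst hlk
        simp
      · rw [Category.assoc, h l (by simp [hl, hlk]), comp_zero]

/-- Some nonzero submodule of `N`, necessarily of full dimension, is a subquotient of `Y`. -/
lemma FinSubgen.dim_le (δ : DimensionFunction.{w} C) {Y N : C} (h : FinSubgen Y N)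
    (hN : δ.IsCritical N) : δ.dim N ≤ δ.dim Y := by
  obtain ⟨α, hN⟩ := hN
  obtain ⟨L, j, f, _, hf⟩ := h.exists_ne_zero hN.not_isZero
  have hi : ¬ IsZero (image f) := fun h => hf (by
    rw [← image.fac f, h.eq_of_src (image.ι f) 0, comp_zero])
  rw [hN.1, ← hN.dim_eq_of_mono (image.ι f) hi]
  exact (δ.dim_le_of_epi (factorThruImage f)).trans (δ.dim_le_of_mono j)

/-- Equivalent critical objects have a common nonzero subobject. -/
lemma exists_common_subobject (δ : DimensionFunction.{w} C) {Y N : C} (h : FinSubgen Y N)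
    (h' : FinSubgen N Y) (hY : δ.IsCritical Y) (hN : δ.IsCritical N) :
    ∃ (L : C) (j : L ⟶ Y) (f : L ⟶ N), Mono j ∧ Mono f ∧ ¬ IsZero L := by
  have hd := le_antisymm (h.dim_le δ hN) (h'.dim_le δ hY)
  obtain ⟨L, j, f, hj, hf⟩ := h.exists_ne_zero hN.not_isZero
  have hL : ¬ IsZero L := fun h => hf (h.eq_of_src _ _)
  obtain ⟨α, hY⟩ := hY
  obtain ⟨β, hN⟩ := hN
  obtain rfl : β = α := by
    rw [hY.1, hN.1] at hd
    exact WithBot.coe_injective hd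
  exact ⟨L, j, f, hj, (hY.of_mono j hL).mono_of_ne_zero hN f hf, hL⟩

end Spec

/-! ### Prime submodules of tiny critical modules. -/

section Tiny

variable {C : Type u} [Category.{v} C] [Abelian C] [IsGrothendieckAbelian.{v} C]

lemma epi_piMap [AB4Star C] {I : Type v} {F G : I → C} (p : ∀ i, F i ⟶ G i) [∀ i, Epi (p i)] :
    Epi (Limits.Pi.map p) := by
  have : ∀ j, Epi ((Discrete.natTrans fun i : Discrete I => p i.as :
    Discrete.functor F ⟶ Discrete.functor G).app j) := fun j => inferInstanceAs (Epi (p j.as))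
  have := NatTrans.epi_of_epi_app (Discrete.natTrans fun i : Discrete I => p i.as :
    Discrete.functor F ⟶ Discrete.functor G)
  exact inferInstanceAs (Epi (lim.map (Discrete.natTrans fun i : Discrete I => p i.as :
    Discrete.functor F ⟶ Discrete.functor G)))

/-- The subquotients of the powers of `L`. -/
def subquotientOfPower (L : C) : ObjectProperty C := fun N =>
  ∃ (I : Type v) (B : C) (i : B ⟶ ∏ᶜ fun _ : I => L) (p : B ⟶ N), Mono i ∧ Epi p

lemma subquotientOfPower_self (L : C) : subquotientOfPower L L :=
  ⟨PUnit, L, Pi.lift fun _ => 𝟙 L, 𝟙 L,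
    mono_of_mono_fac (Pi.lift_π (fun _ : PUnit => 𝟙 L) PUnit.unit), inferInstance⟩

/-- This bounds π[L]. Exactness of products enters in closure under products, where a product of
epimorphisms must be epi. -/
lemma isClosedSubspace_subquotientOfPower [AB4Star C] (L : C) :
    IsClosedSubspace (subquotientOfPower L) where
  sub := ⟨fun {X Y} f _ ⟨I, B, i, p, _, _⟩ =>
    ⟨I, pullback p f, pullback.fst p f ≫ i, pullback.snd p f, mono_comp _ _, inferInstance⟩⟩
  quot := ⟨fun {X Y} f _ ⟨I, B, i, p, hi, _⟩ => ⟨I, B, i, p ≫ f, hi, epi_comp _ _⟩⟩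
  prod := by
    intro I F hF
    choose J B i p hi hp using hF
    refine ⟨Σ k, J k, ∏ᶜ B, Pi.lift fun kj => Pi.π B kj.1 ≫ i kj.1 ≫ Pi.π _ kj.2,
      Limits.Pi.map p, ?_, epi_piMap p⟩
    refine Preadditive.mono_of_cancel_zero _ fun {W} y hy => ?_
    refine Pi.hom_ext _ _ fun k => ?_
    rw [← cancel_mono (i k)]
    refine Pi.hom_ext _ _ fun j => ?_
    simpa using hy =≫ Pi.π (fun _ : Σ k, J k => L) ⟨k, j⟩

lemma piHull_self (M : C) : piHull M M := fun _ _ h => h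

lemma piHull_of_mono {M L N : C} (i : L ⟶ M) [Mono i] (h : piHull L N) : piHull M N :=
  fun Z hZ hM => h Z hZ (hZ.sub.prop_of_mono i hM)

lemma IsPrimeModule.piHull {N L : C} (hN : IsPrimeModule N) (i : L ⟶ N) [Mono i]
    (hL : ¬ IsZero L) : piHull L N := by
  have hne : Subobject.mk i ≠ ⊥ := (ne_bot_iff_not_isZero _).2
    (not_isZero_of_mono (Subobject.underlyingIso i).inv hL)
  have h : NCSpace.piHull (Subobject.mk i : C) N := hN _ hne ▸ piHull_self N
  exact piHull_of_mono (Subobject.underlyingIso i).hom h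

lemma IsPrimeModule.of_mono {N L : C} (hN : IsPrimeModule N) (i : L ⟶ N) [Mono i] :
    IsPrimeModule L := fun K hK => by
  have hL := (ne_bot_iff_not_isZero K).1 hK
  ext M
  exact ⟨fun h Z hZ hK => piHull_of_mono i h Z hZ (hN.piHull (K.arrow ≫ i) hL Z hZ hK),
    piHull_of_mono K.arrow⟩

namespace DimensionFunction

variable {δ : DimensionFunction.{w} C} {α : Ordinal.{w}}

omit [IsGrothendieckAbelian.{v} C] in
lemma IsCriticalOf.eq_zero_of_map_eq_zero {O X : C} (hO : δ.IsCriticalOf α O) (f : X ⟶ O)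
    (h : (δ.toQuotient α).map f = 0) : f = 0 := by
  rw [ObjectProperty.SerreClassLocalization.map_eq_zero_iff _ (δ.below α)] at h
  by_contra hf
  have hi : ¬ IsZero (Abelian.image f) := fun h0 => hf (by
    rw [← Abelian.image.fac f, h0.eq_of_src (Abelian.image.ι f) 0, comp_zero])
  have h' : δ.dim (Abelian.image f) < α := h
  rw [hO.dim_eq_of_mono (Abelian.image.ι f) hi] at h'
  exact lt_irrefl _ h'

omit [IsGrothendieckAbelian.{v} C] in
/-- A jointly monomorphic family of morphisms from a noetherian object to a tiny critical one has
a finite jointly monomorphic subfamily. -/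
lemma exists_finite_jointly_mono {O B : C} [IsNoetherianObject B] (hO : δ.IsCriticalOf α O)
    (ht : IsTinySimple ((δ.toQuotient α).obj O)) {I : Type*} (g : I → (B ⟶ O))
    (hg : ∀ ⦃Z : C⦄ (y : Z ⟶ B), (∀ k, y ≫ g k = 0) → y = 0) :
    ∃ (t : ℕ) (e : Fin t → I), ∀ ⦃Z : C⦄ (y : Z ⟶ B), (∀ a, y ≫ g (e a) = 0) → y = 0 := by
  have := ObjectProperty.SerreClassLocalization.hasKernels (δ.toQuotient α) (δ.below α)
  have := isNoetherianObject_localization (δ.below α) (δ.toQuotient α) B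
  have := ht.1
  have := ht.2 ((δ.toQuotient α).obj B) inferInstance
  -- By Schur, End(S) is a division ring, so the span of the family in a finite-dimensional space is
  -- spanned by finitely many members. A map killed by these is killed by the whole span, and
  -- vanishing in the quotient category lifts back because `O` is critical.
  have hfg : (Submodule.span (End ((δ.toQuotient α).obj O))
      (Set.range fun k => (δ.toQuotient α).map (g k))).FG := IsNoetherian.noetherian _
  obtain ⟨s, hs, hspan⟩ := (Submodule.fg_span_iff_fg_span_finset_subset _).1 hfg
  choose k hk using fun x : s => hs x.2
  refine ⟨s.card, fun a => k (s.equivFin.symm a), fun Z y hy => hg y fun l => ?_⟩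
  apply hO.eq_zero_of_map_eq_zero
  rw [Functor.map_comp]
  have hl : (δ.toQuotient α).map (g l) ∈ Submodule.span (End ((δ.toQuotient α).obj O))
      (s : Set ((δ.toQuotient α).obj B ⟶ (δ.toQuotient α).obj O)) :=
    hspan ▸ Submodule.subset_span ⟨l, rfl⟩
  generalize (δ.toQuotient α).map (g l) = f at hl ⊢
  induction hl using Submodule.span_induction with
  | mem x hx =>
    have h1 := hy (s.equivFin ⟨x, hx⟩)
    simp only [Equiv.symm_apply_apply] at h1
    have h2 : (δ.toQuotient α).map (g (k ⟨x, hx⟩)) = x := hk ⟨x, hx⟩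
    rw [← h2, ← Functor.map_comp, h1, Functor.map_zero]
  | zero => exact comp_zero
  | add x z _ _ hx hz => rw [Preadditive.comp_add, hx, hz, add_zero]
  | smul r x _ hx =>
    change _ ≫ x ≫ r = 0
    rw [← Category.assoc, hx, zero_comp]

/-- If products are exact, noetherian prime subobjects of tiny critical objects are in
`Spec(X)`. -/
lemma isSpecModule_of_isPrimeModule [AB4Star C] (hC : IsLocallyNoetherian C) {O N : C}
    (hO : δ.IsCriticalOf α O) (ht : IsTinySimple ((δ.toQuotient α).obj O)) (j : N ⟶ O) [Mono j]
    [IsNoetherianObject N] (hN : IsPrimeModule N) (hN0 : ¬ IsZero N) : IsSpecModule N := by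
  refine isSpecModule_iff.2 ⟨hN0, fun L i _ hL => ?_⟩
  obtain ⟨I, B₀, b₀, p₀, _, _⟩ := hN.piHull i hL _ (isClosedSubspace_subquotientOfPower L)
    (subquotientOfPower_self L)
  obtain ⟨B, b, _, _, hp⟩ := hC.exists_noetherian_epi p₀
  have hjoint ⦃Z : C⦄ (y : Z ⟶ B)
      (hy : ∀ k, y ≫ (b ≫ b₀) ≫ Pi.π (fun _ : I => L) k = 0) : y = 0 := by
    rw [← cancel_mono (b ≫ b₀), zero_comp]
    exact Pi.hom_ext _ _ fun k => by rw [Category.assoc, hy, zero_comp]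
  -- The coordinates B → L, followed by L ≤ N ≤ O, are jointly mono maps into the tiny module.
  obtain ⟨t, e, he⟩ := exists_finite_jointly_mono hO ht
    (fun k => ((b ≫ b₀) ≫ Pi.π (fun _ : I => L) k) ≫ i ≫ j) (fun Z y hy => hjoint y fun k => by
      rw [← cancel_mono (i ≫ j), zero_comp, ← hy k]
      simp only [Category.assoc])
  refine ⟨t, B, biproduct.lift fun a => (b ≫ b₀) ≫ Pi.π (fun _ : I => L) (e a), b ≫ p₀, ?_, hp⟩
  refine Preadditive.mono_of_cancel_zero _ fun {Z} y hy => he y fun a => ?_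
  have h1 : y ≫ (b ≫ b₀) ≫ Pi.π (fun _ : I => L) (e a) = 0 := by
    simpa using hy =≫ biproduct.π _ a
  rw [← Category.assoc, h1, zero_comp]

end DimensionFunction

end Tiny

/-! ### Comparison of the two spectra. -/

section Comparison

variable {C : Type u} [Category.{v} C] [Abelian C]

lemma InjSpectrum.nonempty_mk_E_iso (E : IndecInjective C) :
    Nonempty (InjSpectrum.E (Quotient.mk (injSetoid C) E) ≅ E.1) :=
  Quotient.mk_out (s := injSetoid C) E

lemma InjSpectrum.ext_of_iso {x y : InjSpectrum C} (h : Nonempty (x.E ≅ y.E)) : x = y := by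
  rw [← Quotient.out_eq x, ← Quotient.out_eq y]
  exact Quotient.sound h

lemma InjSpectrum.injective_E (x : InjSpectrum C) : Injective x.E := (Quotient.out x).2.1

lemma InjSpectrum.indecomposable_E (x : InjSpectrum C) : Indecomposable x.E :=
  (Quotient.out x).2.2

/-- Every point of the spectrum is represented by a critical object. -/
lemma Spectrum.exists_isCritical (hC : IsLocallyNoetherian C) (δ : DimensionFunction.{w} C)
    (p : Spectrum C) : ∃ N : SpecModule C, δ.IsCritical N.1 ∧ Spectrum.mk N = p := by
  obtain ⟨M, rfl⟩ := p.exists_rep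
  obtain ⟨N, i, hi, hN⟩ := δ.exists_isCritical hC M.2.1
  exact ⟨⟨N, M.2.of_mono i hN.not_isZero⟩, hN, Spectrum.mk_eq_of_mono (M := M) i⟩

lemma Spectrum.eq_of_isInjectiveHull {M N : SpecModule C} {E : C} (hM : IsInjectiveHull M.1 E)
    (hN : IsInjectiveHull N.1 E) : Spectrum.mk M = Spectrum.mk N := by
  obtain ⟨-, f, hf, -⟩ := (isInjectiveHull_iff _ _).1 hM
  obtain ⟨-, g, hg, hge⟩ := (isInjectiveHull_iff _ _).1 hN
  have hL : ¬ IsZero (pullback f g) := not_isZero_pullback M.2.1 hge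
  let L : SpecModule C := ⟨pullback f g, M.2.of_mono (pullback.fst f g) hL⟩
  exact (Spectrum.mk_eq_of_mono (L := L) (M := M) (pullback.fst f g)).symm.trans
    (Spectrum.mk_eq_of_mono (L := L) (M := N) (pullback.snd f g))

variable [IsGrothendieckAbelian.{v} C]

/-- Equivalent critical objects have the same injective hull. -/
lemma isInjectiveHull_of_mk_eq {δ : DimensionFunction.{w} C} {M N : SpecModule C} {E : C}
    (hM : δ.IsCritical M.1) (hN : δ.IsCritical N.1) (h : Spectrum.mk M = Spectrum.mk N)
    (hE : IsInjectiveHull M.1 E) : IsInjectiveHull N.1 E := by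
  obtain ⟨h₁, h₂⟩ : FinSubgen M.1 N.1 ∧ FinSubgen N.1 M.1 := Quotient.exact h
  obtain ⟨L, j, f, _, _, hL⟩ := exists_common_subobject δ h₁ h₂ hM hN
  obtain ⟨E', hE'⟩ := exists_isInjectiveHull N.1
  have h3 := hE.of_isEssential j (hM.isUniform.isEssential hL j)
  have h4 := hE'.of_isEssential f (hN.isUniform.isEssential hL f)
  obtain ⟨e⟩ := h4.nonempty_iso (hM.of_mono j hL).isUniform h3
  exact hE'.of_iso e

lemma support_ne_bot {Z : ObjectProperty C} (hZ : IsWeaklyClosed Z) {N M : C} (i : N ⟶ M)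
    [Mono i] (hN : Z N) (hN0 : ¬ IsZero N) : support Z M ≠ ⊥ := by
  have hmem : Subobject.mk i ∈ {K : Subobject M | Z (K : C)} :=
    hZ.sub.prop_of_mono (Subobject.underlyingIso i).hom hN
  intro h
  refine (ne_bot_iff_not_isZero (Subobject.mk i)).2
    (not_isZero_of_mono (Subobject.underlyingIso i).inv hN0) (le_bot_iff.1 (h ▸ le_sSup hmem))

lemma InjSpectrum.rel_of_le {x y : InjSpectrum C} (h : x ≤ y) : x.Rel y := by
  have htop : (⊤ : Subobject y.E) ≠ ⊥ := fun h0 => by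
    refine (ne_bot_iff_not_isZero (⊤ : Subobject y.E)).2 (fun h1 => y.indecomposable_E.1 ?_) h0
    exact h1.of_iso (asIso (⊤ : Subobject y.E).arrow).symm
  intro h0
  refine h ⊤ htop (le_bot_iff.1 (h0 ▸ sSup_le_sSup fun K hK => ?_))
  exact sigma_trans hK (FinSubgen.of_mono (⊤ : Subobject y.E).arrow).sigma

/-- By essentiality `K` meets `N` in a nonzero submodule, which subgenerates `N` and therefore `M`;
so `M` is a nonzero submodule of `x.E` lying in σ[K]. -/
lemma InjSpectrum.le_of_sigma {M N : SpecModule C} {x y : InjSpectrum C}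
    (hM : IsInjectiveHull M.1 x.E) (hN : IsInjectiveHull N.1 y.E) (h : sigma N.1 M.1) :
    x ≤ y := by
  intro K hK
  obtain ⟨-, f, hf, -⟩ := (isInjectiveHull_iff _ _).1 hM
  obtain ⟨-, g, hg, hge⟩ := (isInjectiveHull_iff _ _).1 hN
  have hL : ¬ IsZero (pullback K.arrow g) :=
    not_isZero_pullback ((ne_bot_iff_not_isZero K).1 hK) hge
  have h1 : sigma (pullback K.arrow g) N.1 :=
    ((isSpecModule_iff.1 N.2).2 (pullback.snd K.arrow g) hL).sigma
  have h2 : sigma (K : C) (pullback K.arrow g) :=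
    (FinSubgen.of_mono (pullback.fst K.arrow g)).sigma
  exact support_ne_bot (sigma_isWeaklyClosed _) f (sigma_trans (sigma_trans h h1) h2) M.2.1

/-- A tiny point is the class of the injective hull of a critical object of `Spec(X)`. -/
lemma exists_isInjectiveHull_of_mem_tinyPoints (hC : IsLocallyNoetherian C)
    (δ : DimensionFunction.{w} C) (hP : EnoughPrimes C) [AB4Star C] {x : InjSpectrum C}
    (hx : x ∈ δ.tinyPoints) :
    ∃ N : SpecModule C, δ.IsCritical N.1 ∧ ∃ f : N.1 ⟶ x.E, Mono f := by
  obtain ⟨O, -, α, hO, ht⟩ := hx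
  obtain ⟨P, hP0, hP⟩ := hP (O : C) hO.not_isZero
  obtain ⟨N, i, hi, _, hN⟩ := hC.exists_noetherian_subobject ((ne_bot_iff_not_isZero P).1 hP0)
  have hm : Mono (i ≫ P.arrow) := mono_comp _ _
  exact ⟨⟨N, DimensionFunction.isSpecModule_of_isPrimeModule hC hO ht (i ≫ P.arrow)
    (hP.of_mono i) hN⟩, ⟨α, hO.of_mono (i ≫ P.arrow) hN⟩, (i ≫ P.arrow) ≫ O.arrow, mono_comp _ _⟩

end Comparison

end NCSpace

end

theorem mainTheorem12 {C : Type u} [Category.{v} C] [Abelian C] [IsGrothendieckAbelian.{v} C]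
    (hC : NCSpace.IsLocallyNoetherian C) (δ : NCSpace.DimensionFunction.{w} C) :
    ∃ Φ : NCSpace.Spectrum C → NCSpace.InjSpectrum C,
      (∀ p : NCSpace.Spectrum C, ∃ N : NCSpace.SpecModule C,
        δ.IsCritical N.1 ∧ NCSpace.Spectrum.mk N = p) ∧
      (∀ N : NCSpace.SpecModule C, δ.IsCritical N.1 →
        NCSpace.IsInjectiveHull N.1 (Φ (NCSpace.Spectrum.mk N)).E) ∧
      Function.Injective Φ ∧
      Monotone Φ ∧
      (∀ p q : NCSpace.Spectrum C, p ≤ q → (Φ p).Rel (Φ q)) ∧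
      (NCSpace.EnoughPrimes C → AB4Star C → δ.tinyPoints ⊆ Set.range Φ) := by
  have hcrit := NCSpace.Spectrum.exists_isCritical hC δ
  choose R hR hRp using hcrit
  choose H hH using fun p => NCSpace.exists_isInjectiveHull (R p).1
  -- `Φ` is built from chosen critical representatives; `hullN` shows that the choice is immaterial.
  let Φ : NCSpace.Spectrum C → NCSpace.InjSpectrum C := fun p =>
    Quotient.mk (NCSpace.injSetoid C) ⟨H p, (hH p).1, (hH p).indecomposable (hR p).isUniform⟩
  have hull (p : NCSpace.Spectrum C) : NCSpace.IsInjectiveHull (R p).1 (Φ p).E :=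
    (hH p).of_iso (NCSpace.InjSpectrum.nonempty_mk_E_iso
      ⟨H p, (hH p).1, (hH p).indecomposable (hR p).isUniform⟩).some.symm
  have hullN (N : NCSpace.SpecModule C) (hN : δ.IsCritical N.1) :
      NCSpace.IsInjectiveHull N.1 (Φ (NCSpace.Spectrum.mk N)).E :=
    NCSpace.isInjectiveHull_of_mk_eq (hR _) hN (hRp _) (hull _)
  have hmono : Monotone Φ := fun p q h => by
    refine NCSpace.InjSpectrum.le_of_sigma (hull p) (hull q) ?_
    rw [← hRp p, ← hRp q] at h
    exact h
  refine ⟨Φ, fun p => ⟨R p, hR p, hRp p⟩, hullN, fun p q h => ?_, hmono,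
    fun p q h => NCSpace.InjSpectrum.rel_of_le (hmono h), fun hP hAB x hx => ?_⟩
  · rw [← hRp p, ← hRp q]
    exact NCSpace.Spectrum.eq_of_isInjectiveHull (hull p) (h ▸ hull q)
  · obtain ⟨N, hN, f, _⟩ := NCSpace.exists_isInjectiveHull_of_mem_tinyPoints hC δ hP hx
    have := x.injective_E
    exact ⟨NCSpace.Spectrum.mk N, NCSpace.InjSpectrum.ext_of_iso
      ((hullN N hN).iso_of_indecomposable N.2.1 x.indecomposable_E f)⟩
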